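/- **Setting.** Let $n_1,n_2,p\to\infty$ along an arbitrary sequence (index $k$ suppressed). For positive definite $p\times p$ matrices $\Sigma_1=(\sigma_{ij1})$, $\Sigma_2=(\sigma_{ij2})$, let $X_1,\dots,X_{n_1}$ be i.i.d. $N_p(0,\Sigma_1)$ and, independently, $Y_1,\dots,Y_{n_2}$ i.i.d. $N_p(0,\Sigma_2)$. Let $\sum^{*}$ denote summation over mutually distinct indices and put $$A=\frac{\sum^{*}_{u,v}(X_u'X_v)^2}{n_1(n_1-1)}-\frac{2\sum^{*}_{u,v,k}X_u'X_vX_v'X_k}{n_1(n_1-1)(n_1-2)}+\frac{\sum^{*}_{u,v,k,l}X_u'X_vX_k'X_l}{n_1(n_1-1)(n_1-2)(n_1-3)},$$ let $B$ be the same expression in $Y_1,\dots,Y_{n_2}$, and $$C=\frac{\sum_{u,v}(X_u'Y_v)^2}{n_1n_2}-\frac{\sum^{*}_{u,k}\sum_vX_u'Y_vY_v'X_k}{n_1n_2(n_1-1)}-\frac{\sum^{*}_{v,l}\sum_uY_v'X_uX_u'Y_l}{n_1n_2(n_2-1)}+\frac{\sum^{*}_{u,k}\sum^{*}_{v,l}X_u'Y_vX_k'Y_l}{n_1n_2(n_1-1)(n_2-1)}.$$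 Let $T=A+B-2C$ and $\hat\sigma_0=\frac{2}{n_2}A+\frac{2}{n_1}B$. With the sample covariances $\hat\sigma_{ij1}=\frac1{n_1}\sum_u(X_{ui}-\bar X_i)(X_{uj}-\bar X_j)$ and $\hat\theta_{ij1}=\frac1{n_1}\sum_u[(X_{ui}-\bar X_i)(X_{uj}-\bar X_j)-\hat\sigma_{ij1}]^2$, and $\hat\sigma_{ij2},\hat\theta_{ij2}$ defined likewise from the $Y$'s, let $$M=\max_{1\le i\le j\le p}\frac{(\hat\sigma_{ij1}-\hat\sigma_{ij2})^2}{\hat\theta_{ij1}/n_1+\hat\theta_{ij2}/n_2}.$$ Fisher's statistic is $F=-2\log p_T-2\log p_M$, where $p_T=1-\Phi(T/\hat\sigma_0)$ with $\Phi$ the standard normal distribution function, and $p_M=1-G(M-4\log p+\log\log p)$ with $G(x)=\exp(-\frac1{\sqrt{8\pi}}e^{-x/2})$. For $\alpha\in(0,1)$ let $c_\alpha$ be the upper $\alpha$-quantile of $\chi^2_4$. **Alternatives.** Let $\theta_{ij1}=\mathrm{Var}(X_iX_j)$ for $X\sim N_p(0,\Sigma_1)$, and $\theta_{ij2}$ likewise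 for $\Sigma_2$. For a given sequence $\varepsilon\to0$ let $\mathcal G_d$ be the set of pairs of positive definite matrices with $$\frac{\mathrm{tr}(\Sigma_1^2)}{n_1}+\frac{\mathrm{tr}(\Sigma_2^2)}{n_2}\le\varepsilon\,\mathrm{tr}\{(\Sigma_1-\Sigma_2)^2\},$$ and let $\mathcal G_s$ be the set of pairs of positive definite matrices with $$\max_{1\le i\le j\le p}\frac{|\sigma_{ij1}-\sigma_{ij2}|}{\sqrt{\theta_{ij1}/n_1+\theta_{ij2}/n_2}}\ge4\sqrt{\log p}.$$ **Assumptions.** $n_1/(n_1+n_2)\to\gamma\in(0,1)$ and $\log p=o((n_1+n_2)^{1/5})$. The covariance pairs range over a class $\mathcal C$ of pairs of positive definite matrices (depending on $k$) satisfying the following conditions, all $o(\cdot)$ and limits being uniform over $\mathcal C$: 1. $\sum_{i\le q}\lambda_i^2(\Sigma_j)\big/\sum_{i\le p}\lambda_i^2(\Sigma_j)\to0$ for $j=1,2$ and every $q=O(\log p)$, where $\lambda_1\ge\lambda_2\ge\cdots$ are the eigenvalues. 2. For $0<r<1$ let $\mathcal V_i(r)$ be the set of $j\ne i$ with $|\sigma_{ij1}|/\sqrt{\sigma_{ii1}\sigma_{jj1}}\ge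 r$ or $|\sigma_{ij2}|/\sqrt{\sigma_{ii2}\sigma_{jj2}}\ge r$. There are sets $\Upsilon\subset\{1,\dots,p\}$ (which may depend on the pair) with $\mathrm{card}(\Upsilon)=o(p)$ and a constant $\alpha_0>0$ such that $\max_{i\notin\Upsilon}\mathrm{card}\,\mathcal V_i((\log p)^{-1-\alpha_0})=o(p^\kappa)$ for all $\kappa>0$. 3. There is a constant $r_0\in(0,1)$ such that $\mathrm{card}\{i:\mathcal V_i(r_0)\ne\varnothing\}=o(p)$. **Theorem.** Under these assumptions, for every $\alpha\in(0,1)$ and every sequence $\varepsilon\to0$ in the definition of $\mathcal G_d$, $$\inf_{(\Sigma_1,\Sigma_2)\in\mathcal C\cap(\mathcal G_d\cup\mathcal G_s)}P(F\ge c_\alpha)\to1,$$ where the infimum over an empty set is $1$. -/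

import Mathlib

open MeasureTheory ProbabilityTheory Filter Topology
open scoped ENNReal

noncomputable section

namespace FisherCov

/-! ### Gaussian samples -/

/-- Positive definite `p × p` real (covariance) matrices. -/
abbrev PDMatrix (p : ℕ) : Type := {S : Matrix (Fin p) (Fin p) ℝ // S.PosDef}

/-- A sample of `n` vectors in `ℝᵖ`. -/
abbrev Sample (n p : ℕ) : Type := Fin n → EuclideanSpace ℝ (Fin p)

/-- The joint law of two independent samples, the first made of `n₁` i.i.d. `N_p(0, S.1)` vectors,
the second of `n₂` i.i.d. `N_p(0, S.2)` vectors. -/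
def sampleLaw (n₁ n₂ : ℕ) {p : ℕ} (S : PDMatrix p × PDMatrix p) :
    Measure (Sample n₁ p × Sample n₂ p) :=
  (Measure.pi fun _ : Fin n₁ => multivariateGaussian 0 S.1.1).prod
    (Measure.pi fun _ : Fin n₂ => multivariateGaussian 0 S.2.1)

/-! ### The quadratic form statistic

Sums over `Fin m ↪ Fin n` are sums over `m` mutually distinct indices. -/

/-- The unbiased U-statistic estimator of `tr (Σ²)` from one sample. -/
def traceSqEst {n p : ℕ} (X : Sample n p) : ℝ :=
  (1 / ((n : ℝ) * (n - 1))) * ∑ e : Fin 2 ↪ Fin n, (inner ℝ (X (e 0)) (X (e 1))) ^ 2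
  - (2 / ((n : ℝ) * (n - 1) * (n - 2))) * ∑ e : Fin 3 ↪ Fin n,
      inner ℝ (X (e 0)) (X (e 1)) * inner ℝ (X (e 1)) (X (e 2))
  + (1 / ((n : ℝ) * (n - 1) * (n - 2) * (n - 3))) * ∑ e : Fin 4 ↪ Fin n,
      inner ℝ (X (e 0)) (X (e 1)) * inner ℝ (X (e 2)) (X (e 3))

/-- The unbiased U-statistic estimator of `tr (Σ₁ Σ₂)` from two samples. -/
def traceMulEst {n₁ n₂ p : ℕ} (X : Sample n₁ p) (Y : Sample n₂ p) : ℝ :=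
  (1 / ((n₁ : ℝ) * n₂)) * ∑ u : Fin n₁, ∑ v : Fin n₂, (inner ℝ (X u) (Y v)) ^ 2
  - (1 / ((n₁ : ℝ) * n₂ * (n₁ - 1))) * ∑ e : Fin 2 ↪ Fin n₁, ∑ v : Fin n₂,
      inner ℝ (X (e 0)) (Y v) * inner ℝ (Y v) (X (e 1))
  - (1 / ((n₁ : ℝ) * n₂ * (n₂ - 1))) * ∑ f : Fin 2 ↪ Fin n₂, ∑ u : Fin n₁,
      inner ℝ (Y (f 0)) (X u) * inner ℝ (X u) (Y (f 1))
  + (1 / ((n₁ : ℝ) * n₂ * (n₁ - 1) * (n₂ - 1))) * ∑ e : Fin 2 ↪ Fin n₁, ∑ f : Fin 2 ↪ Fin n₂,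
      inner ℝ (X (e 0)) (Y (f 0)) * inner ℝ (X (e 1)) (Y (f 1))

/-- `T = A + B - 2 C`. -/
def quadStat {n₁ n₂ p : ℕ} (X : Sample n₁ p) (Y : Sample n₂ p) : ℝ :=
  traceSqEst X + traceSqEst Y - 2 * traceMulEst X Y

/-- The estimator `(2 / n₂) A + (2 / n₁) B` of the null standard deviation of `T`. -/
def quadStatSd {n₁ n₂ p : ℕ} (X : Sample n₁ p) (Y : Sample n₂ p) : ℝ :=
  (2 / (n₂ : ℝ)) * traceSqEst X + (2 / (n₁ : ℝ)) * traceSqEst Y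

/-! ### The maximum form statistic -/

/-- `i`-th coordinate of the sample mean. -/
def sampleMean {n p : ℕ} (X : Sample n p) (i : Fin p) : ℝ :=
  (1 / (n : ℝ)) * ∑ u, X u i

/-- `(i, j)` entry of the sample covariance matrix. -/
def sampleCov {n p : ℕ} (X : Sample n p) (i j : Fin p) : ℝ :=
  (1 / (n : ℝ)) * ∑ u, (X u i - sampleMean X i) * (X u j - sampleMean X j)

/-- The estimator of `θ_{ij}`. -/
def thetaEst {n p : ℕ} (X : Sample n p) (i j : Fin p) : ℝ :=
  (1 / (n : ℝ)) *
    ∑ u, ((X u i - sampleMean X i) * (X u j - sampleMean X j) - sampleCov X i j) ^ 2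

/-- Index pairs `i ≤ j`. -/
abbrev UpperPair (p : ℕ) : Type := {q : Fin p × Fin p // q.1 ≤ q.2}

/-- `M`, the maximum over `i ≤ j` of the standardized squared differences. -/
def maxStat {n₁ n₂ p : ℕ} (X : Sample n₁ p) (Y : Sample n₂ p) : ℝ :=
  ⨆ q : UpperPair p, (sampleCov X q.1.1 q.1.2 - sampleCov Y q.1.1 q.1.2) ^ 2 /
    (thetaEst X q.1.1 q.1.2 / n₁ + thetaEst Y q.1.1 q.1.2 / n₂)

/-! ### Fisher's combined test -/

/-- The Gumbel-type distribution function. -/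
def gumbelCDF (x : ℝ) : ℝ :=
  Real.exp (-(1 / Real.sqrt (8 * Real.pi)) * Real.exp (-x / 2))

/-- p-value of the quadratic form statistic. -/
def pQuad {n₁ n₂ p : ℕ} (X : Sample n₁ p) (Y : Sample n₂ p) : ℝ :=
  1 - cdf (gaussianReal 0 1) (quadStat X Y / quadStatSd X Y)

/-- p-value of the maximum form statistic. -/
def pMax {n₁ n₂ p : ℕ} (X : Sample n₁ p) (Y : Sample n₂ p) : ℝ :=
  1 - gumbelCDF (maxStat X Y - 4 * Real.log p + Real.log (Real.log p))

/-- Fisher's combined statistic `F`. -/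
def fisherStat {n₁ n₂ p : ℕ} (X : Sample n₁ p) (Y : Sample n₂ p) : ℝ :=
  -2 * Real.log (pQuad X Y) - 2 * Real.log (pMax X Y)

/-- The chi-squared distribution with `d` degrees of freedom: the law of the sum of squares of `d`
independent standard normal variables. -/
def chiSquared (d : ℕ) : Measure ℝ :=
  (Measure.pi fun _ : Fin d => gaussianReal 0 1).map fun x => ∑ i, x i ^ 2

/-- The upper `α`-quantile of a distribution on the line. -/
def upperQuantile (μ : Measure ℝ) (α : ℝ) : ℝ := sInf {x | 1 - α ≤ cdf μ x}

/-- Probability that Fisher's test of nominal level `α` rejects, for covariance pair `S`. -/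
def fisherPower (α : ℝ) (n₁ n₂ : ℕ) {p : ℕ} (S : PDMatrix p × PDMatrix p) : ℝ≥0∞ :=
  sampleLaw n₁ n₂ S {Z | upperQuantile (chiSquared 4) α ≤ fisherStat Z.1 Z.2}

/-! ### Alternatives -/

/-- `θ_{ij} = Var (X_i X_j)` for `X ∼ N_p(0, S)`. -/
def theta {p : ℕ} (S : PDMatrix p) (i j : Fin p) : ℝ :=
  Var[fun x : EuclideanSpace ℝ (Fin p) => x i * x j; multivariateGaussian 0 S.1]

/-- The dense alternative, with `ε` the rate in
`tr(Σ₁²)/n₁ + tr(Σ₂²)/n₂ = o(tr((Σ₁-Σ₂)²))`. -/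
def denseAlt (n₁ n₂ p : ℕ) (ε : ℝ) : Set (PDMatrix p × PDMatrix p) :=
  {S | (S.1.1 ^ 2).trace / n₁ + (S.2.1 ^ 2).trace / n₂ ≤ ε * ((S.1.1 - S.2.1) ^ 2).trace}

/-- The sparse alternative. -/
def sparseAlt (n₁ n₂ p : ℕ) : Set (PDMatrix p × PDMatrix p) :=
  {S | 4 * Real.sqrt (Real.log p) ≤ ⨆ q : UpperPair p,
    |S.1.1 q.1.1 q.1.2 - S.2.1 q.1.1 q.1.2| /
      Real.sqrt (theta S.1 q.1.1 q.1.2 / n₁ + theta S.2 q.1.1 q.1.2 / n₂)}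

/-! ### Conditions on the covariance matrices

A condition of the form "`a = o(b)`" for a family of covariance pairs is read uniformly over the
family: for each `δ > 0`, eventually `a ≤ δ b` for all members of the family. -/

/-- Sum of the squares of the `q` largest eigenvalues. -/
def topEigSq {p : ℕ} (S : PDMatrix p) (q : ℕ) : ℝ :=
  ∑ i with i.val < q, S.2.isHermitian.eigenvalues₀ i ^ 2

/-- For every `q = O(log p)`, the `q` largest squared eigenvalues of either matrix are negligible
in the sum of all `p` of them. -/
def SpectrumSpread (p : ℕ → ℕ) (𝒞 : ∀ k, Set (PDMatrix (p k) × PDMatrix (p k))) : Prop :=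
  ∀ C > (0 : ℝ), ∀ δ > (0 : ℝ), ∀ᶠ k in atTop, ∀ S ∈ 𝒞 k, ∀ q : ℕ, (q : ℝ) ≤ C * Real.log (p k) →
    topEigSq S.1 q / topEigSq S.1 (p k) ≤ δ ∧ topEigSq S.2 q / topEigSq S.2 (p k) ≤ δ

/-- Absolute correlation of the coordinates `i` and `j`. -/
def absCorr {p : ℕ} (S : PDMatrix p) (i j : Fin p) : ℝ :=
  |S.1 i j| / Real.sqrt (S.1 i i * S.1 j j)

open Classical in
/-- The other coordinates whose correlation with coordinate `i` is at least `r` in `X` or in `Y`. -/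
def highCorr {p : ℕ} (S : PDMatrix p × PDMatrix p) (r : ℝ) (i : Fin p) : Finset (Fin p) :=
  {j | j ≠ i ∧ (r ≤ absCorr S.1 i j ∨ r ≤ absCorr S.2 i j)}

/-- `s_i(a)`, the number of coordinates having correlation at least `(log p)^(-1-a)` with `i`. -/
def corrCount {p : ℕ} (S : PDMatrix p × PDMatrix p) (a : ℝ) (i : Fin p) : ℕ :=
  (highCorr S (Real.log p ^ (-1 - a)) i).card

open Classical in
/-- The coordinates having correlation at least `r` with some other coordinate. -/
def corrSet {p : ℕ} (S : PDMatrix p × PDMatrix p) (r : ℝ) : Finset (Fin p) :=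
  {i | (highCorr S r i).Nonempty}

/-- Few coordinates are strongly correlated, and, off a set `Υ` of `o(p)` coordinates, each
coordinate has non-negligible correlation with only `o(p^κ)` others, for every `κ > 0`. -/
def WeaklyCorrelated (p : ℕ → ℕ) (𝒞 : ∀ k, Set (PDMatrix (p k) × PDMatrix (p k))) : Prop :=
  (∃ Υ : ∀ k, PDMatrix (p k) × PDMatrix (p k) → Finset (Fin (p k)),
    (∀ δ > (0 : ℝ), ∀ᶠ k in atTop, ∀ S ∈ 𝒞 k, ((Υ k S).card : ℝ) ≤ δ * p k) ∧
    ∃ α₀ > (0 : ℝ), ∀ κ > (0 : ℝ), ∀ δ > (0 : ℝ), ∀ᶠ k in atTop, ∀ S ∈ 𝒞 k, ∀ i ∉ Υ k S,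
      (corrCount S α₀ i : ℝ) ≤ δ * (p k : ℝ) ^ κ) ∧
  ∃ r₀ : ℝ, 0 < r₀ ∧ r₀ < 1 ∧
    ∀ δ > (0 : ℝ), ∀ᶠ k in atTop, ∀ S ∈ 𝒞 k, ((corrSet S r₀).card : ℝ) ≤ δ * p k

end FisherCov

end

/-!
Fisher's statistic is the sum of the two nonnegative numbers `-2 log p_T` and `-2 log p_M`, so the
test rejects as soon as one of the two p-values is smaller than a constant. Under a dense
alternative this happens to `p_T`, under a sparse alternative to `p_M`, and in both cases bounds of
second moments and Chebyshev's inequality suffice. All bounds are non-asymptotic and hold for every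
pair of positive definite matrices in the alternative, whence the uniformity.

*Dense alternatives.* Write `F_j = tr (Σ_j²)` and `Δ = tr ((Σ₁ - Σ₂)²)`. By Hoeffding's
decomposition `A - F₁` is the sum of `(2 / n₁) ∑ (X_u' Σ₁ X_u - F₁)` and averages of completely
degenerate kernels (`exists_traceSqEst_eq`), and similarly for `B` and `C`
(`exists_traceMulEst_eq`). Degenerate kernels with different sets of variables are orthogonal
(`Degenerate.integral_mul_eq_zero`), which bounds the second moment of their averages
(`SqBound.sum_degenerate`). In `T = A + B - 2 C` the linear terms combine into averages of quadratic
forms with matrix `±(Σ₁ - Σ₂)`, each of second moment at most `3 Δ F_j` by `SqBound.bilin_self`.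
Altogether `E (T - Δ)² = O(Δ a + a²)` with `a = F₁ / n₁ + F₂ / n₂ ≤ ε Δ` when the sample sizes are
comparable (`SqBound.quadStat_sub`, `dense_secondMoment_le`), so `T ≥ Δ / 2` with high probability,
whereas `A` and `B` are within a factor of `F₁` and `F₂`, so that the estimated standard deviation
is positive and `O(ε Δ)` (`sampleLaw_quadStat_lt_le`).

*Sparse alternatives.* It is enough to look at one entry `(i, j)` at which the maximum defining the
alternative is attained. There `(σ_ij1 - σ_ij2)² ≥ 16 V log p` with `V = θ_ij1 / n₁ + θ_ij2 / n₂`,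
the sample covariances have errors `O(√V)`, and the estimators of `θ_ij` are positive and at most
`5 / 2` times their targets (`pi_sampleCov_thetaEst_le`). Hence `M ≥ 5 log p - O(1)` with high
probability (`sampleLaw_maxStat_lt_le`), beyond the centring `4 log p - log log p`.
-/

open MeasureTheory ProbabilityTheory Filter Topology
open scoped ENNReal

noncomputable section

namespace FisherCov

/-! ### Random variables with moments of all orders -/

section Moments

variable {Ω Ω' : Type*} {mΩ : MeasurableSpace Ω} {mΩ' : MeasurableSpace Ω'}

/-- The real random variable `f` has finite moments of all orders under `μ`. -/
@[fun_prop]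
def HasMoments (μ : Measure Ω) (f : Ω → ℝ) : Prop := ∀ q : ℕ, MemLp f q μ

variable {μ : Measure Ω} {f g : Ω → ℝ}

lemma HasMoments.integrable (hf : HasMoments μ f) : Integrable f μ := by
  simpa using memLp_one_iff_integrable.1 (by simpa using hf 1)

@[fun_prop]
lemma HasMoments.const [IsFiniteMeasure μ] (c : ℝ) : HasMoments μ fun _ => c :=
  fun _ => memLp_const c

@[fun_prop]
lemma HasMoments.add (hf : HasMoments μ f) (hg : HasMoments μ g) :
    HasMoments μ fun ω => f ω + g ω := fun q => (hf q).add (hg q)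

@[fun_prop]
lemma HasMoments.sub (hf : HasMoments μ f) (hg : HasMoments μ g) :
    HasMoments μ fun ω => f ω - g ω := fun q => (hf q).sub (hg q)

@[fun_prop]
lemma HasMoments.neg (hf : HasMoments μ f) : HasMoments μ fun ω => -f ω := fun q => (hf q).neg

@[fun_prop]
lemma HasMoments.mul (hf : HasMoments μ f) (hg : HasMoments μ g) :
    HasMoments μ fun ω => f ω * g ω := by
  intro q
  have : ENNReal.HolderTriple ((2 * q : ℕ) : ℝ≥0∞) ((2 * q : ℕ) : ℝ≥0∞) (q : ℝ≥0∞) := by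
    constructor
    rcases Nat.eq_zero_or_pos q with rfl | hq
    · simp
    · push_cast
      rw [ENNReal.mul_inv (by simp) (by simp), ← add_mul, ENNReal.inv_two_add_inv_two, one_mul]
  exact (hg (2 * q)).mul (hf (2 * q))

@[fun_prop]
lemma HasMoments.pow [IsFiniteMeasure μ] (hf : HasMoments μ f) (m : ℕ) :
    HasMoments μ fun ω => f ω ^ m := by
  induction m with
  | zero => simpa using HasMoments.const 1
  | succ m ih => simpa only [pow_succ] using ih.mul hf

@[fun_prop]
lemma HasMoments.sum {J : Type*} {s : Finset J} {F : J → Ω → ℝ} (h : ∀ a, HasMoments μ (F a)) :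
    HasMoments μ fun ω => ∑ a ∈ s, F a ω := fun q => memLp_finsetSum s fun a _ => h a q

lemma HasMoments.comp {ν : Measure Ω'} {F : Ω' → ℝ} {φ : Ω → Ω'} (hF : HasMoments ν F)
    (hφ : MeasurePreserving φ μ ν) : HasMoments μ fun ω => F (φ ω) :=
  fun q => (hF q).comp_measurePreserving hφ

lemma integral_comp_of_measurePreserving {ν : Measure Ω'} {F : Ω' → ℝ} {φ : Ω → Ω'}
    (hF : HasMoments ν F) (hφ : MeasurePreserving φ μ ν) :
    ∫ ω, F (φ ω) ∂μ = ∫ x, F x ∂ν := by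
  rw [← hφ.map_eq, integral_map hφ.measurable.aemeasurable
    (by rw [hφ.map_eq]; exact (hF 1).aestronglyMeasurable)]

/-- `f` has moments of all orders, and its second moment is at most `K`. -/
structure SqBound (μ : Measure Ω) (f : Ω → ℝ) (K : ℝ) : Prop where
  moments : HasMoments μ f
  integral_sq_le : ∫ ω, f ω ^ 2 ∂μ ≤ K

variable {K L : ℝ}

lemma SqBound.mono (h : SqBound μ f K) (hKL : K ≤ L) : SqBound μ f L :=
  ⟨h.1, h.2.trans hKL⟩

lemma SqBound.neg (h : SqBound μ f K) : SqBound μ (fun ω => -f ω) K :=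
  ⟨h.1.neg, by simpa using h.2⟩

variable [IsProbabilityMeasure μ]

lemma SqBound.const_mul (h : SqBound μ f K) (c : ℝ) :
    SqBound μ (fun ω => c * f ω) (c ^ 2 * K) := by
  refine ⟨(HasMoments.const c).mul h.1, ?_⟩
  simp_rw [mul_pow]
  rw [integral_const_mul]
  exact mul_le_mul_of_nonneg_left h.2 (sq_nonneg c)

lemma SqBound.add (hf : SqBound μ f K) (hg : SqBound μ g L) :
    SqBound μ (fun ω => f ω + g ω) (2 * (K + L)) := by
  have h1 := hf.1
  have h2 := hg.1
  refine ⟨by fun_prop, ?_⟩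
  calc ∫ ω, (f ω + g ω) ^ 2 ∂μ ≤ ∫ ω, (2 * f ω ^ 2 + 2 * g ω ^ 2) ∂μ := by
        refine integral_mono (HasMoments.integrable (by fun_prop))
          (HasMoments.integrable (by fun_prop)) fun ω => ?_
        simp only
        nlinarith [sq_nonneg (f ω - g ω)]
    _ = 2 * ∫ ω, f ω ^ 2 ∂μ + 2 * ∫ ω, g ω ^ 2 ∂μ := by
        rw [integral_add (HasMoments.integrable (by fun_prop))
          (HasMoments.integrable (by fun_prop)), integral_const_mul, integral_const_mul]
    _ ≤ _ := by linarith [hf.2, hg.2]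

lemma SqBound.sub (hf : SqBound μ f K) (hg : SqBound μ g L) :
    SqBound μ (fun ω => f ω - g ω) (2 * (K + L)) := by
  simpa only [sub_eq_add_neg] using hf.add hg.neg

/-- Centering does not increase the second moment. -/
lemma SqBound.sub_integral (hf : SqBound μ f K) {m : ℝ} (hm : ∫ ω, f ω ∂μ = m) :
    SqBound μ (fun ω => f ω - m) K := by
  have h1 := hf.1
  refine ⟨by fun_prop, ?_⟩
  have : ∫ ω, (f ω - m) ^ 2 ∂μ = ∫ ω, f ω ^ 2 ∂μ - m ^ 2 := by
    have e : ∀ ω, (f ω - m) ^ 2 = f ω ^ 2 - ((2 * m) * f ω - m ^ 2) := fun ω => by ring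
    simp_rw [e]
    rw [integral_sub (HasMoments.integrable (by fun_prop)) (HasMoments.integrable (by fun_prop)),
      integral_sub (HasMoments.integrable (by fun_prop)) (HasMoments.integrable (by fun_prop)),
      integral_const_mul, hm]
    simp
    ring
  rw [this]
  nlinarith [hf.2, sq_nonneg m]

/-- Chebyshev's inequality. -/
lemma SqBound.meas_le (hf : SqBound μ f K) {t : ℝ} (ht : 0 < t) :
    μ {ω | t ≤ |f ω|} ≤ ENNReal.ofReal (K / t ^ 2) := by
  have h1 := hf.1
  have h := mul_meas_ge_le_integral_of_nonneg (μ := μ) (f := fun ω => f ω ^ 2)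
    (ae_of_all _ fun ω => sq_nonneg _) (HasMoments.integrable (by fun_prop)) (t ^ 2)
  have e : {ω | t ^ 2 ≤ f ω ^ 2} = {ω | t ≤ |f ω|} := by
    ext ω
    simp only [Set.mem_ofPred_eq]
    rw [sq_le_sq, abs_of_pos ht]
  rw [e] at h
  rw [← ENNReal.ofReal_toReal (measure_ne_top μ {ω | t ≤ |f ω|})]
  refine ENNReal.ofReal_le_ofReal ?_
  rw [le_div_iff₀ (by positivity), mul_comm]
  exact h.trans hf.2

/-- Markov's inequality. -/
lemma HasMoments.meas_le (hf : HasMoments μ f) (h0 : ∀ ω, 0 ≤ f ω) (hK : ∫ ω, f ω ∂μ ≤ K) {t : ℝ}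
    (ht : 0 < t) : μ {ω | t ≤ f ω} ≤ ENNReal.ofReal (K / t) := by
  have h := mul_meas_ge_le_integral_of_nonneg (ae_of_all μ h0) hf.integrable t
  rw [← ENNReal.ofReal_toReal (measure_ne_top μ {ω | t ≤ f ω})]
  refine ENNReal.ofReal_le_ofReal ?_
  rw [le_div_iff₀ ht, mul_comm]
  exact h.trans hK

end Moments

/-! ### Orthogonality of degenerate kernels -/

section Degenerate

open Function

variable {ι : Type*} [Fintype ι] [DecidableEq ι] {E : Type*} {mE : MeasurableSpace E}
  {μ : ι → Measure E} [∀ i, IsProbabilityMeasure (μ i)]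

/-- Resampling one coordinate preserves a product measure. -/
lemma measurePreserving_update (i : ι) :
    MeasurePreserving (fun z : (ι → E) × E => update z.1 i z.2)
      ((Measure.pi μ).prod (μ i)) (Measure.pi μ) := by
  have hm : Measurable fun z : (ι → E) × E => update z.1 i z.2 := by
    rw [measurable_pi_iff]
    intro j
    rcases eq_or_ne j i with rfl | h
    · simpa using measurable_snd
    · simp only [update_of_ne h]
      exact (measurable_pi_apply j).comp measurable_fst
  refine ⟨hm, (Measure.pi_eq fun s hs => ?_).symm⟩
  have e : (fun z : (ι → E) × E => update z.1 i z.2) ⁻¹' (Set.univ.pi s) =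
      (Set.univ.pi (update s i Set.univ)) ×ˢ s i := by
    ext z
    simp only [Set.mem_preimage, Set.mem_pi, Set.mem_univ, true_implies, Set.mem_prod]
    constructor
    · intro h
      refine ⟨fun j => ?_, by simpa using h i⟩
      rcases eq_or_ne j i with rfl | hj
      · simp
      · simpa [update_of_ne hj] using h j
    · rintro ⟨h, h'⟩ j
      rcases eq_or_ne j i with rfl | hj
      · simpa using h'
      · simpa [update_of_ne hj] using h j
  rw [Measure.map_apply hm (MeasurableSet.univ_pi hs), e, Measure.prod_prod, Measure.pi_pi,
    ← Finset.prod_erase_mul _ _ (Finset.mem_univ i),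
    ← Finset.prod_erase_mul _ _ (Finset.mem_univ i)]
  simp only [update_self, measure_univ, mul_one]
  congr 1
  refine Finset.prod_congr rfl fun j hj => ?_
  rw [update_of_ne (Finset.ne_of_mem_erase hj)]

/-- Integration over a product space, one coordinate first. -/
lemma integral_pi_eq_integral_update {f : (ι → E) → ℝ} (hf : Integrable f (Measure.pi μ)) (i : ι) :
    ∫ ω, f ω ∂Measure.pi μ = ∫ ω, ∫ x, f (update ω i x) ∂μ i ∂Measure.pi μ := by
  have hp := measurePreserving_update (μ := μ) i
  have hi : Integrable (fun z : (ι → E) × E => f (update z.1 i z.2))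
      ((Measure.pi μ).prod (μ i)) :=
    (hp.integrable_comp hf.aestronglyMeasurable).2 hf
  rw [← integral_prod _ hi]
  conv_lhs => rw [← hp.map_eq]
  exact integral_map hp.measurable.aemeasurable (by rw [hp.map_eq]; exact hf.aestronglyMeasurable)

/-- No integrability is needed: the integral of a non-integrable function is zero by convention. -/
lemma integral_pi_eq_zero {f : (ι → E) → ℝ} (i : ι)
    (h : ∀ ω, ∫ x, f (update ω i x) ∂μ i = 0) : ∫ ω, f ω ∂Measure.pi μ = 0 := by
  by_cases hf : Integrable f (Measure.pi μ)
  · rw [integral_pi_eq_integral_update hf i]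
    simp [h]
  · exact integral_undef hf

/-- A completely degenerate kernel: a function of the coordinates in `s` only which integrates to
zero in each of them, with all moments and second moment at most `K`. -/
structure Degenerate (μ : ι → Measure E) (s : Finset ι) (W : (ι → E) → ℝ) (K : ℝ) : Prop where
  sqBound : SqBound (Measure.pi μ) W K
  update_eq : ∀ i ∉ s, ∀ ω x, W (update ω i x) = W ω
  integral_update : ∀ i ∈ s, ∀ ω, ∫ x, W (update ω i x) ∂μ i = 0

lemma integral_mul_eq_zero_of_notMem {s t : Finset ι} {V W : (ι → E) → ℝ} {K L : ℝ}
    (hV : Degenerate μ s V K) (hW : Degenerate μ t W L) {i : ι} (hs : i ∈ s) (ht : i ∉ t) :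
    ∫ ω, V ω * W ω ∂Measure.pi μ = 0 := by
  refine integral_pi_eq_zero i fun ω => ?_
  simp_rw [hW.update_eq i ht]
  rw [integral_mul_const, hV.integral_update i hs, zero_mul]

/-- Degenerate kernels with different sets of variables are orthogonal. -/
lemma Degenerate.integral_mul_eq_zero {s t : Finset ι} {V W : (ι → E) → ℝ} {K L : ℝ}
    (hV : Degenerate μ s V K) (hW : Degenerate μ t W L) (hst : s ≠ t) :
    ∫ ω, V ω * W ω ∂Measure.pi μ = 0 := by
  by_cases h : s ⊆ t
  · obtain ⟨i, ht, hs⟩ := Set.not_subset.1 fun h' : t ⊆ s => hst (h.antisymm h')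
    simp_rw [mul_comm (V _)]
    exact integral_mul_eq_zero_of_notMem hW hV ht hs
  · obtain ⟨i, hs, ht⟩ := Finset.not_subset.1 h
    exact integral_mul_eq_zero_of_notMem hV hW hs ht

/-- Second moment of a sum of degenerate kernels: only pairs of summands with the same set of
variables contribute, and there are at most `N` of these for each summand. -/
lemma SqBound.sum_degenerate {J : Type*} [Fintype J] {supp : J → Finset ι}
    {W : J → (ι → E) → ℝ} {K : ℝ} (h : ∀ a, Degenerate μ (supp a) (W a) K) {N : ℕ}
    (hN : ∀ a, (Finset.univ.filter fun b => supp b = supp a).card ≤ N) :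
    SqBound (Measure.pi μ) (fun ω => ∑ a, W a ω) (Fintype.card J * (N * K)) := by
  have hm := fun a => (h a).1.1
  refine ⟨by fun_prop, ?_⟩
  rcases isEmpty_or_nonempty J with hJ | ⟨⟨a₀⟩⟩
  · simp
  have hK : 0 ≤ K := (integral_nonneg fun ω => sq_nonneg (W a₀ ω)).trans (h a₀).1.2
  have hab : ∀ a b, ∫ ω, W a ω * W b ω ∂Measure.pi μ ≤ if supp b = supp a then K else 0 := by
    intro a b
    split_ifs with hs
    · have h1 := hm a
      have h2 := hm b
      calc ∫ ω, W a ω * W b ω ∂Measure.pi μ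
          ≤ ∫ ω, ((1 / 2) * W a ω ^ 2 + (1 / 2) * W b ω ^ 2) ∂Measure.pi μ := by
            refine integral_mono (HasMoments.integrable (by fun_prop))
              (HasMoments.integrable (by fun_prop)) fun ω => ?_
            simp only
            nlinarith [sq_nonneg (W a ω - W b ω)]
        _ = (1 / 2) * ∫ ω, W a ω ^ 2 ∂Measure.pi μ + (1 / 2) * ∫ ω, W b ω ^ 2 ∂Measure.pi μ := by
            rw [integral_add (HasMoments.integrable (by fun_prop))
              (HasMoments.integrable (by fun_prop)), integral_const_mul, integral_const_mul]
        _ ≤ K := by linarith [(h a).1.2, (h b).1.2]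
    · exact ((h a).integral_mul_eq_zero (h b) fun e => hs e.symm).le
  calc ∫ ω, (∑ a, W a ω) ^ 2 ∂Measure.pi μ
      = ∑ a, ∑ b, ∫ ω, W a ω * W b ω ∂Measure.pi μ := by
        simp_rw [sq, Finset.sum_mul_sum]
        rw [integral_finsetSum _ fun a _ => HasMoments.integrable (by
          have := hm a; fun_prop)]
        refine Finset.sum_congr rfl fun a _ => ?_
        rw [integral_finsetSum _ fun b _ => HasMoments.integrable (by
          have := hm a; have := hm b; fun_prop)]
    _ ≤ ∑ a, ∑ b, if supp b = supp a then K else 0 :=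
        Finset.sum_le_sum fun a _ => Finset.sum_le_sum fun b _ => hab a b
    _ = ∑ a, ((Finset.univ.filter fun b => supp b = supp a).card : ℝ) * K := by
        refine Finset.sum_congr rfl fun a _ => ?_
        rw [← Finset.sum_filter, Finset.sum_const, nsmul_eq_mul]
    _ ≤ ∑ _a : J, (N : ℝ) * K := by
        refine Finset.sum_le_sum fun a _ => mul_le_mul_of_nonneg_right ?_ hK
        exact_mod_cast hN a
    _ = _ := by simp

/-- Second moment of a sum of independent centred variables, one for each coordinate. -/
lemma SqBound.sum_coordinates {J : Type*} [Fintype J] {φ : J ↪ ι} {g : E → ℝ} {K : ℝ}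
    (hg : ∀ a, SqBound (μ (φ a)) g K) (h0 : ∀ a, ∫ x, g x ∂μ (φ a) = 0) :
    SqBound (Measure.pi μ) (fun ω => ∑ a, g (ω (φ a))) (Fintype.card J * K) := by
  have h : ∀ a, Degenerate μ {φ a} (fun ω => g (ω (φ a))) K := by
    intro a
    have hp := measurePreserving_eval μ (φ a)
    refine ⟨⟨(hg a).1.comp hp, ?_⟩, fun i hi ω x => ?_, fun i hi ω => ?_⟩
    · have := (hg a).1
      rw [integral_comp_of_measurePreserving (F := fun x => g x ^ 2) (by fun_prop) hp]
      exact (hg a).2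
    · rw [update_of_ne fun e => hi (by simp [e])]
    · obtain rfl : i = φ a := by simpa using hi
      simpa using h0 a
  have := SqBound.sum_degenerate h (N := 1) fun a => by
    rw [Finset.card_le_one]
    intro b hb c hc
    simp only [Finset.mem_filter, Finset.mem_univ, true_and, Finset.singleton_inj,
      φ.injective.eq_iff] at hb hc
    rw [hb, hc]
  simpa using this

end Degenerate

/-! ### Moments of Gaussian vectors -/

section RealGaussian

@[fun_prop]
lemma hasMoments_gaussianReal (m : ℝ) (v : NNReal) : HasMoments (gaussianReal m v) fun t => t :=
  fun q => memLp_id_gaussianReal' q (by simp)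

lemma integral_pow_gaussianReal {v : ℝ} (hv : 0 ≤ v) (m : ℕ) :
    ∫ t, t ^ m ∂gaussianReal 0 v.toNNReal = √v ^ m * ∫ t, t ^ m ∂gaussianReal 0 1 := by
  have h : gaussianReal 0 v.toNNReal = (gaussianReal 0 1).map (fun t => √v * t) := by
    rw [gaussianReal_map_const_mul]
    congr 1
    · simp
    · ext
      simp [hv]
  rw [h, integral_map (by fun_prop) (by fun_prop), ← integral_const_mul]
  simp_rw [mul_pow]

lemma integral_sq_gaussianReal : ∫ t, t ^ 2 ∂gaussianReal 0 1 = 1 := by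
  have := variance_id_gaussianReal (μ := 0) (v := 1)
  rw [variance_eq_integral (by fun_prop)] at this
  simpa using this

/-- The fourth moment of the standard normal law. For independent standard normal `s` and `t` the
sum `s + t` is distributed as `√2 t`, so that the moment `m` satisfies `4 m = 2 m + 6`. -/
lemma integral_pow_four_gaussianReal : ∫ t, t ^ 4 ∂gaussianReal 0 1 = 3 := by
  set ν := gaussianReal 0 1 with hν
  have hfst : MeasurePreserving Prod.fst (ν.prod ν) ν := measurePreserving_fst
  have hsnd : MeasurePreserving Prod.snd (ν.prod ν) ν := measurePreserving_snd
  have h1 : HasMoments (ν.prod ν) fun z : ℝ × ℝ => z.1 := (hasMoments_gaussianReal 0 1).comp hfst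
  have h2 : HasMoments (ν.prod ν) fun z : ℝ × ℝ => z.2 := (hasMoments_gaussianReal 0 1).comp hsnd
  have hsum : (ν.prod ν).map (fun z : ℝ × ℝ => z.1 + z.2) = gaussianReal 0 (2 : ℝ).toNNReal := by
    have := gaussianReal_conv_gaussianReal (m₁ := 0) (m₂ := 0) (v₁ := 1) (v₂ := 1)
    rw [Measure.conv, add_zero] at this
    rw [this]
    congr 1
    ext
    norm_num
  have hL : ∫ z, (z.1 + z.2) ^ 4 ∂ν.prod ν = 4 * ∫ t, t ^ 4 ∂ν := by
    have := integral_pow_gaussianReal (v := 2) (by norm_num) 4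
    rw [← hsum, integral_map (by fun_prop) (by fun_prop)] at this
    rw [this, show √2 ^ 4 = (√2 ^ 2) ^ 2 by ring, Real.sq_sqrt (by norm_num)]
    norm_num [hν]
  have hp : ∀ a b : ℕ, ∫ z, z.1 ^ a * z.2 ^ b ∂ν.prod ν = (∫ t, t ^ a ∂ν) * ∫ t, t ^ b ∂ν :=
    fun a b => integral_prod_mul (fun t => t ^ a) fun t => t ^ b
  have hR : ∫ z, (z.1 + z.2) ^ 4 ∂ν.prod ν = ∫ z, (z.1 ^ 4 * z.2 ^ 0 + 4 * (z.1 ^ 3 * z.2 ^ 1) +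
      6 * (z.1 ^ 2 * z.2 ^ 2) + 4 * (z.1 ^ 1 * z.2 ^ 3) + z.1 ^ 0 * z.2 ^ 4) ∂ν.prod ν := by
    congr 1
    ext z
    ring
  have h01 : ∫ t, t ^ 1 ∂ν = 0 := by simp [hν]
  have h00 : ∫ t : ℝ, t ^ 0 ∂ν = 1 := by simp
  have h02 : ∫ t, t ^ 2 ∂ν = 1 := integral_sq_gaussianReal
  rw [integral_add (HasMoments.integrable (by fun_prop)) (HasMoments.integrable (by fun_prop)),
    integral_add (HasMoments.integrable (by fun_prop)) (HasMoments.integrable (by fun_prop)),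
    integral_add (HasMoments.integrable (by fun_prop)) (HasMoments.integrable (by fun_prop)),
    integral_add (HasMoments.integrable (by fun_prop)) (HasMoments.integrable (by fun_prop)),
    integral_const_mul, integral_const_mul, integral_const_mul, hp, hp, hp, hp, hp, h00, h01,
    h02] at hR
  linarith

end RealGaussian

section GaussianVector

variable {p : ℕ} {S : Matrix (Fin p) (Fin p) ℝ}

/-- The bilinear form `x' M y`. -/
def bilin (M : Matrix (Fin p) (Fin p) ℝ) (x y : EuclideanSpace ℝ (Fin p)) : ℝ :=
  ∑ a, ∑ b, M a b * (x a * y b)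

/-- The squared Frobenius norm of a matrix. -/
def frobSq (M : Matrix (Fin p) (Fin p) ℝ) : ℝ := ∑ a, ∑ b, M a b ^ 2

/-- `tr (M' N)`, the Frobenius inner product. -/
def frobInner (M N : Matrix (Fin p) (Fin p) ℝ) : ℝ := ∑ a, ∑ b, M a b * N a b

lemma frobSq_nonneg (M : Matrix (Fin p) (Fin p) ℝ) : 0 ≤ frobSq M :=
  Finset.sum_nonneg fun _ _ => Finset.sum_nonneg fun _ _ => sq_nonneg _

lemma frobInner_comm (M N : Matrix (Fin p) (Fin p) ℝ) : frobInner M N = frobInner N M := by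
  simp only [frobInner, mul_comm]

@[fun_prop]
lemma hasMoments_coord (m : EuclideanSpace ℝ (Fin p)) (a : Fin p) :
    HasMoments (multivariateGaussian m S) fun x => x a :=
  fun q => IsGaussian.memLp_dual _ (EuclideanSpace.proj (𝕜 := ℝ) a) q (by simp)

lemma inner_eq_sum (x y : EuclideanSpace ℝ (Fin p)) : inner ℝ x y = ∑ a, x a * y a := by
  simp [PiLp.inner_apply, mul_comm]

/-- Linear forms of a centred Gaussian vector are normal, with variance `a' S a`. -/
lemma map_inner_multivariateGaussian (hS : S.PosSemidef) (a : EuclideanSpace ℝ (Fin p)) :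
    (multivariateGaussian 0 S).map (fun x => inner ℝ a x) =
      gaussianReal 0 (bilin S a a).toNNReal := by
  have h := IsGaussian.map_eq_gaussianReal (μ := multivariateGaussian 0 S) (innerSL ℝ a)
  have h0 : ∫ x, innerSL ℝ a x ∂multivariateGaussian 0 S = 0 := by
    rw [IsGaussian.integral_dual]
    simp
  have hv : Var[innerSL ℝ a; multivariateGaussian 0 S] = bilin S a a := by
    have := covarianceBilin_self (μ := multivariateGaussian 0 S) IsGaussian.memLp_two_id a
    rw [covarianceBilin_multivariateGaussian hS] at this
    simp only [coe_innerSL_apply]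
    rw [← this]
    simp only [dotProduct, Matrix.mulVec, bilin, Finset.mul_sum]
    exact Finset.sum_congr rfl fun i _ => Finset.sum_congr rfl fun j _ => by ring
  rw [h0, hv] at h
  simpa using h

lemma bilin_self_nonneg (hS : S.PosSemidef) (a : EuclideanSpace ℝ (Fin p)) :
    0 ≤ bilin S a a := by
  have := covarianceBilin_self (μ := multivariateGaussian 0 S) IsGaussian.memLp_two_id a
  rw [covarianceBilin_multivariateGaussian hS] at this
  have h2 : bilin S a a = Var[fun x => inner ℝ a x; multivariateGaussian 0 S] := by
    rw [← this]
    simp only [dotProduct, Matrix.mulVec, bilin, Finset.mul_sum]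
    exact Finset.sum_congr rfl fun i _ => Finset.sum_congr rfl fun j _ => by ring
  rw [h2]
  exact variance_nonneg _ _

lemma integral_inner_pow (hS : S.PosSemidef) (a : EuclideanSpace ℝ (Fin p)) (m : ℕ) :
    ∫ x, inner ℝ a x ^ m ∂multivariateGaussian 0 S =
      √(bilin S a a) ^ m * ∫ t, t ^ m ∂gaussianReal 0 1 := by
  rw [← integral_pow_gaussianReal (bilin_self_nonneg hS a), ← map_inner_multivariateGaussian hS,
    integral_map (by fun_prop) (by fun_prop)]

lemma integral_inner_pow_four (hS : S.PosSemidef) (a : EuclideanSpace ℝ (Fin p)) :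
    ∫ x, inner ℝ a x ^ 4 ∂multivariateGaussian 0 S = 3 * bilin S a a ^ 2 := by
  rw [integral_inner_pow hS, integral_pow_four_gaussianReal,
    show √(bilin S a a) ^ 4 = (√(bilin S a a) ^ 2) ^ 2 by ring,
    Real.sq_sqrt (bilin_self_nonneg hS a)]
  ring

lemma integral_coord (a : Fin p) : ∫ x, x a ∂multivariateGaussian 0 S = 0 := by
  have := IsGaussian.integral_dual (μ := multivariateGaussian 0 S) (EuclideanSpace.proj (𝕜 := ℝ) a)
  simpa using this

lemma integral_coord_mul (hS : S.PosSemidef) (a b : Fin p) :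
    ∫ x, x a * x b ∂multivariateGaussian 0 S = S a b := by
  have h := covariance_eval_multivariateGaussian (μ := 0) hS a b
  rw [covariance] at h
  simpa [integral_coord] using h

/-- Isserlis' formula for the mixed fourth moments of a centred Gaussian vector, obtained from the
fourth moments of linear forms by polarization. -/
lemma integral_coord_four (hS : S.PosSemidef) (i j k l : Fin p) :
    ∫ x, x i * x j * (x k * x l) ∂multivariateGaussian 0 S =
      S i j * S k l + S i k * S j l + S i l * S j k := by
  set ν := multivariateGaussian 0 S
  have hsym : ∀ a b, S a b = S b a := fun a b => by simpa using hS.isHermitian.apply b a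
  -- the fourth moment of a linear form in the four coordinates
  have key : ∀ r s t : ℝ, ∫ x, (x i + r * x j + s * x k + t * x l) ^ 4 ∂ν =
      3 * (S i i + r ^ 2 * S j j + s ^ 2 * S k k + t ^ 2 * S l l + 2 * r * S i j + 2 * s * S i k +
        2 * t * S i l + 2 * r * s * S j k + 2 * r * t * S j l + 2 * s * t * S k l) ^ 2 := by
    intro r s t
    have hw : ∃ w : EuclideanSpace ℝ (Fin p), ∀ x,
        inner ℝ w x = x i + r * x j + s * x k + t * x l := by
      refine ⟨EuclideanSpace.single i 1 + r • EuclideanSpace.single j 1 +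
        s • EuclideanSpace.single k 1 + t • EuclideanSpace.single l 1, fun x => ?_⟩
      simp [inner_add_left, inner_smul_left, EuclideanSpace.inner_single_left]
    obtain ⟨w, hw⟩ := hw
    have h2 : ∫ x, inner ℝ w x ^ 2 ∂ν = bilin S w w := by
      rw [integral_inner_pow hS, integral_sq_gaussianReal, Real.sq_sqrt (bilin_self_nonneg hS w),
        mul_one]
    have h4 := integral_inner_pow_four hS w
    simp_rw [hw] at h2 h4
    rw [h4, ← h2]
    have e : ∀ x : EuclideanSpace ℝ (Fin p), (x i + r * x j + s * x k + t * x l) ^ 2 =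
        x i * x i + r ^ 2 * (x j * x j) + s ^ 2 * (x k * x k) + t ^ 2 * (x l * x l) +
        2 * r * (x i * x j) + 2 * s * (x i * x k) + 2 * t * (x i * x l) +
        2 * r * s * (x j * x k) + 2 * r * t * (x j * x l) + 2 * s * t * (x k * x l) :=
      fun x => by ring
    simp_rw [e]
    repeat rw [integral_add (HasMoments.integrable (by fun_prop))
      (HasMoments.integrable (by fun_prop))]
    simp only [integral_const_mul, ν, integral_coord_mul hS]
  -- polarization of the fourth power over the eight choices of signs
  have e : ∀ x : EuclideanSpace ℝ (Fin p), x i * x j * (x k * x l) = (1 / 192) * (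
      (x i + 1 * x j + 1 * x k + 1 * x l) ^ 4 - (x i + 1 * x j + 1 * x k + (-1) * x l) ^ 4
      - (x i + 1 * x j + (-1) * x k + 1 * x l) ^ 4 + (x i + 1 * x j + (-1) * x k + (-1) * x l) ^ 4
      - (x i + (-1) * x j + 1 * x k + 1 * x l) ^ 4 + (x i + (-1) * x j + 1 * x k + (-1) * x l) ^ 4
      + (x i + (-1) * x j + (-1) * x k + 1 * x l) ^ 4
      - (x i + (-1) * x j + (-1) * x k + (-1) * x l) ^ 4) := fun x => by ring
  simp_rw [e]
  rw [integral_const_mul]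
  repeat first
    | rw [integral_add (HasMoments.integrable (by fun_prop)) (HasMoments.integrable (by fun_prop))]
    | rw [integral_sub (HasMoments.integrable (by fun_prop)) (HasMoments.integrable (by fun_prop))]
  simp only [key]
  ring

lemma frobInner_sq_le (M N : Matrix (Fin p) (Fin p) ℝ) :
    frobInner M N ^ 2 ≤ frobSq M * frobSq N := by
  simp only [frobInner, frobSq, ← Fintype.sum_prod_type']
  exact Finset.sum_mul_sq_le_sq_mul_sq _ _ _

/-- Cauchy–Schwarz over quadruples of indices, the second factor being a tensor product with the
indices paired by `σ`. -/
lemma sum_mul_tensor_le (D M N : Matrix (Fin p) (Fin p) ℝ) (K : ℝ)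
    (hM : frobSq D * frobSq M ≤ K) (hN : frobSq D * frobSq N ≤ K)
    (σ : (Fin p × Fin p) × (Fin p × Fin p) ≃ (Fin p × Fin p) × (Fin p × Fin p)) :
    ∑ q : (Fin p × Fin p) × (Fin p × Fin p), D q.1.1 q.1.2 * D q.2.1 q.2.2 *
      (M (σ q).1.1 (σ q).1.2 * N (σ q).2.1 (σ q).2.2) ≤ K := by
  have hK : 0 ≤ K := (mul_nonneg (frobSq_nonneg D) (frobSq_nonneg M)).trans hM
  have h1 : ∀ A B : Matrix (Fin p) (Fin p) ℝ, ∑ q : (Fin p × Fin p) × (Fin p × Fin p),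
      (A q.1.1 q.1.2 * B q.2.1 q.2.2) ^ 2 = frobSq A * frobSq B := by
    intro A B
    rw [Fintype.sum_prod_type]
    simp only [frobSq, ← Fintype.sum_prod_type', Finset.sum_mul_sum, mul_pow]
  have h2 := Finset.sum_mul_sq_le_sq_mul_sq Finset.univ
    (fun q : (Fin p × Fin p) × (Fin p × Fin p) => D q.1.1 q.1.2 * D q.2.1 q.2.2)
    (fun q => M (σ q).1.1 (σ q).1.2 * N (σ q).2.1 (σ q).2.2)
  rw [h1, Equiv.sum_comp σ fun q => (M q.1.1 q.1.2 * N q.2.1 q.2.2) ^ 2, h1] at h2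
  refine abs_le_of_sq_le_sq' ?_ hK |>.2
  calc _ ≤ _ := h2
    _ = (frobSq D * frobSq M) * (frobSq D * frobSq N) := by ring
    _ ≤ K * K := mul_le_mul hM hN (mul_nonneg (frobSq_nonneg D) (frobSq_nonneg N)) hK
    _ = K ^ 2 := by ring

lemma integral_bilin_self (hS : S.PosSemidef) (D : Matrix (Fin p) (Fin p) ℝ) :
    ∫ x, bilin D x x ∂multivariateGaussian 0 S = frobInner D S := by
  simp only [bilin, frobInner]
  rw [integral_finsetSum _ fun a _ => HasMoments.integrable (by fun_prop)]
  refine Finset.sum_congr rfl fun a _ => ?_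
  rw [integral_finsetSum _ fun b _ => HasMoments.integrable (by fun_prop)]
  refine Finset.sum_congr rfl fun b _ => ?_
  rw [integral_const_mul, integral_coord_mul hS]

lemma bilin_eq_sum_prod (D : Matrix (Fin p) (Fin p) ℝ) (x y : EuclideanSpace ℝ (Fin p)) :
    bilin D x y = ∑ q : Fin p × Fin p, D q.1 q.2 * (x q.1 * y q.2) := by
  rw [bilin, ← Fintype.sum_prod_type']

lemma bilin_sq_eq_sum (D : Matrix (Fin p) (Fin p) ℝ) (x y : EuclideanSpace ℝ (Fin p)) :
    bilin D x y ^ 2 = ∑ q : (Fin p × Fin p) × (Fin p × Fin p), D q.1.1 q.1.2 * D q.2.1 q.2.2 *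
      ((x q.1.1 * x q.2.1) * (y q.1.2 * y q.2.2)) := by
  rw [Fintype.sum_prod_type, sq, bilin_eq_sum_prod, Finset.sum_mul_sum]
  exact Finset.sum_congr rfl fun a _ => Finset.sum_congr rfl fun b _ => by ring

/-- The second moment of the quadratic form `x' D x` is at most `3 ‖D‖² ‖S‖²` in Frobenius norms.
The bound involves no trace of `S`, which is what makes the quadratic form statistic consistent in
high dimension. -/
lemma SqBound.bilin_self (hS : S.PosSemidef) (D : Matrix (Fin p) (Fin p) ℝ) :
    SqBound (multivariateGaussian 0 S) (fun x => bilin D x x) (3 * (frobSq D * frobSq S)) := by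
  refine ⟨by unfold bilin; fun_prop, ?_⟩
  simp_rw [bilin_sq_eq_sum]
  rw [integral_finsetSum _ fun a _ => HasMoments.integrable (by fun_prop)]
  simp_rw [integral_const_mul, integral_coord_four hS, mul_add, Finset.sum_add_distrib]
  have e := fun σ => sum_mul_tensor_le D S S _ le_rfl le_rfl σ
  -- the three pairings of the four indices
  have e1 := e ⟨fun q => ((q.1.1, q.2.1), (q.1.2, q.2.2)),
    fun q => ((q.1.1, q.2.1), (q.1.2, q.2.2)),
    fun _ => rfl, fun _ => rfl⟩
  have e2 := e (Equiv.refl _)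
  have e3 := e ⟨fun q => ((q.1.1, q.2.2), (q.2.1, q.1.2)),
    fun q => ((q.1.1, q.2.2), (q.2.1, q.1.2)),
    fun _ => rfl, fun _ => rfl⟩
  simp only [Equiv.coe_fn_mk, Equiv.refl_apply] at e1 e2 e3
  linarith

end GaussianVector

/-! ### The degenerate kernels of the quadratic form statistic -/

section Kernels

open Function

variable {ι : Type*} {p : ℕ} {S : ι → Matrix (Fin p) (Fin p) ℝ}

variable (S) in
/-- The kernel `(x_i' x_j)²` with its projections on functions of one variable removed. -/
def sqKernel (i j : ι) (ω : ι → EuclideanSpace ℝ (Fin p)) : ℝ :=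
  inner ℝ (ω i) (ω j) ^ 2 - bilin (S j) (ω i) (ω i) - bilin (S i) (ω j) (ω j)
    + frobInner (S i) (S j)

variable (S) in
/-- The kernel `x_i' x_j x_j' x_k` with its projection on functions of `x_i, x_k` removed. -/
def pathKernel (i j k : ι) (ω : ι → EuclideanSpace ℝ (Fin p)) : ℝ :=
  inner ℝ (ω i) (ω j) * inner ℝ (ω j) (ω k) - bilin (S j) (ω i) (ω k)

variable [Fintype ι]

@[fun_prop]
lemma hasMoments_eval_coord (i : ι) (a : Fin p) :
    HasMoments (Measure.pi fun i => multivariateGaussian 0 (S i)) fun ω => ω i a :=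
  (hasMoments_coord 0 a).comp
    (measurePreserving_eval (fun i => multivariateGaussian 0 (S i)) i)

lemma SqBound.comp_eval {i : ι} {g : EuclideanSpace ℝ (Fin p) → ℝ} {K : ℝ}
    (h : SqBound (multivariateGaussian 0 (S i)) g K) :
    SqBound (Measure.pi fun i => multivariateGaussian 0 (S i)) (fun ω => g (ω i)) K := by
  have hp := measurePreserving_eval (fun i => multivariateGaussian 0 (S i)) i
  have h1 := h.1
  refine ⟨h.1.comp hp, ?_⟩
  have := integral_comp_of_measurePreserving (F := fun x => g x ^ 2) (by fun_prop) hp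
  exact this.trans_le h.2

variable {M : Matrix (Fin p) (Fin p) ℝ}

lemma integral_bilin_left (M' : Matrix (Fin p) (Fin p) ℝ) (z : EuclideanSpace ℝ (Fin p)) :
    ∫ x, bilin M' x z ∂multivariateGaussian 0 M = 0 := by
  simp only [bilin]
  rw [integral_finsetSum _ fun a _ => HasMoments.integrable (by fun_prop)]
  refine Finset.sum_eq_zero fun a _ => ?_
  rw [integral_finsetSum _ fun b _ => HasMoments.integrable (by fun_prop)]
  refine Finset.sum_eq_zero fun b _ => ?_
  rw [integral_const_mul, integral_mul_const, integral_coord, zero_mul, mul_zero]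

lemma integral_bilin_right (M' : Matrix (Fin p) (Fin p) ℝ) (z : EuclideanSpace ℝ (Fin p)) :
    ∫ x, bilin M' z x ∂multivariateGaussian 0 M = 0 := by
  have : ∀ x, bilin M' z x = bilin M'.transpose x z := by
    intro x
    simp only [bilin, Matrix.transpose_apply]
    rw [Finset.sum_comm]
    exact Finset.sum_congr rfl fun i _ => Finset.sum_congr rfl fun j _ => by ring
  simp_rw [this, integral_bilin_left]

lemma bilin_one (x y : EuclideanSpace ℝ (Fin p)) : bilin 1 x y = inner ℝ x y := by
  simp [bilin, inner_eq_sum, Matrix.one_apply]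

lemma integral_inner_left (z : EuclideanSpace ℝ (Fin p)) :
    ∫ x, inner ℝ x z ∂multivariateGaussian 0 M = 0 := by
  simpa [bilin_one] using integral_bilin_left (M := M) 1 z

lemma integral_inner_right (z : EuclideanSpace ℝ (Fin p)) :
    ∫ x, inner ℝ z x ∂multivariateGaussian 0 M = 0 := by
  simpa [bilin_one] using integral_bilin_right (M := M) 1 z

lemma integral_inner_mul_inner (hM : M.PosSemidef) (z w : EuclideanSpace ℝ (Fin p)) :
    ∫ x, inner ℝ z x * inner ℝ x w ∂multivariateGaussian 0 M = bilin M z w := by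
  simp only [inner_eq_sum, Finset.sum_mul_sum, bilin]
  rw [integral_finsetSum _ fun a _ => HasMoments.integrable (by fun_prop)]
  refine Finset.sum_congr rfl fun a _ => ?_
  rw [integral_finsetSum _ fun b _ => HasMoments.integrable (by fun_prop)]
  refine Finset.sum_congr rfl fun b _ => ?_
  have e : ∀ x : EuclideanSpace ℝ (Fin p), z a * x a * (x b * w b) = z a * w b * (x a * x b) :=
    fun x => by ring
  simp_rw [e]
  rw [integral_const_mul, integral_coord_mul hM]
  ring

lemma integral_inner_sq (hM : M.PosSemidef) (z : EuclideanSpace ℝ (Fin p)) :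
    ∫ x, inner ℝ x z ^ 2 ∂multivariateGaussian 0 M = bilin M z z := by
  rw [← integral_inner_mul_inner hM]
  simp_rw [sq, real_inner_comm z]

variable [DecidableEq ι] (hS : ∀ i, (S i).PosSemidef)
include hS

/-- The fourth moment of the inner product of two independent Gaussian vectors. -/
lemma integral_inner_pow_four_le {i j : ι} (hij : i ≠ j) :
    ∫ ω, inner ℝ (ω i) (ω j) ^ 4 ∂(Measure.pi fun i => multivariateGaussian 0 (S i)) ≤
      9 * (frobSq (S i) * frobSq (S j)) := by
  rw [integral_pi_eq_integral_update (HasMoments.integrable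
    (by simp only [inner_eq_sum]; fun_prop)) i]
  simp only [update_self, update_of_ne hij.symm]
  have e : ∀ z, ∫ x, inner ℝ x z ^ 4 ∂multivariateGaussian 0 (S i) = 3 * bilin (S i) z z ^ 2 := by
    intro z
    rw [← integral_inner_pow_four (hS i)]
    simp_rw [real_inner_comm z]
  simp_rw [e]
  rw [integral_const_mul]
  have := (SqBound.comp_eval (S := S) (SqBound.bilin_self (hS j) (S i))).2
  linarith

lemma SqBound.inner_sq {i j : ι} (hij : i ≠ j) :
    SqBound (Measure.pi fun i => multivariateGaussian 0 (S i))
      (fun ω => inner ℝ (ω i) (ω j) ^ 2) (9 * (frobSq (S i) * frobSq (S j))) := by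
  refine ⟨by simp only [inner_eq_sum]; fun_prop, ?_⟩
  simp_rw [← pow_mul]
  exact integral_inner_pow_four_le hS hij

/-- The two inner products may share a vector, since only their fourth moments enter. -/
lemma SqBound.inner_mul_inner {i j k l : ι} (hij : i ≠ j) (hkl : k ≠ l) {K : ℝ}
    (h1 : frobSq (S i) * frobSq (S j) ≤ K) (h2 : frobSq (S k) * frobSq (S l) ≤ K) :
    SqBound (Measure.pi fun i => multivariateGaussian 0 (S i))
      (fun ω => inner ℝ (ω i) (ω j) * inner ℝ (ω k) (ω l)) (9 * K) := by
  have e1 := integral_inner_pow_four_le hS hij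
  have e2 := integral_inner_pow_four_le hS hkl
  simp only [inner_eq_sum] at e1 e2 ⊢
  refine ⟨by fun_prop, ?_⟩
  calc _ ≤ ∫ ω, ((1 / 2) * (∑ a, ω i a * ω j a) ^ 4 + (1 / 2) * (∑ a, ω k a * ω l a) ^ 4)
        ∂(Measure.pi fun i => multivariateGaussian 0 (S i)) := by
        refine integral_mono (HasMoments.integrable (by fun_prop))
          (HasMoments.integrable (by fun_prop)) fun ω => ?_
        simp only
        nlinarith [sq_nonneg ((∑ a, ω i a * ω j a) ^ 2 - (∑ a, ω k a * ω l a) ^ 2)]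
    _ ≤ _ := by
        rw [integral_add (HasMoments.integrable (by fun_prop))
          (HasMoments.integrable (by fun_prop)), integral_const_mul, integral_const_mul]
        linarith

/-- The second moment of the bilinear form `x_i' D x_k` in two independent vectors is
`tr (D' S_i D S_k)`, which Cauchy–Schwarz bounds by Frobenius norms. -/
lemma SqBound.bilin_pair {i k : ι} (hik : i ≠ k) {D : Matrix (Fin p) (Fin p) ℝ} {K : ℝ}
    (h1 : frobSq D * frobSq (S i) ≤ K) (h2 : frobSq D * frobSq (S k) ≤ K) :
    SqBound (Measure.pi fun i => multivariateGaussian 0 (S i))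
      (fun ω => bilin D (ω i) (ω k)) K := by
  refine ⟨by unfold bilin; fun_prop, ?_⟩
  simp_rw [bilin_sq_eq_sum]
  rw [integral_finsetSum _ fun a _ => HasMoments.integrable (by fun_prop)]
  have e : ∀ a b c d : Fin p, ∫ ω, ω i a * ω i b * (ω k c * ω k d)
      ∂(Measure.pi fun i => multivariateGaussian 0 (S i)) = S i a b * S k c d := by
    intro a b c d
    rw [integral_pi_eq_integral_update (HasMoments.integrable (by fun_prop)) i]
    simp only [update_self, update_of_ne hik.symm]
    simp_rw [integral_mul_const, integral_coord_mul (hS i)]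
    rw [integral_const_mul]
    have := integral_comp_of_measurePreserving (F := fun x => x c * x d) (by fun_prop)
      (measurePreserving_eval (fun i => multivariateGaussian 0 (S i)) k)
    simp only [Function.eval] at this
    rw [this, integral_coord_mul (hS k)]
  simp_rw [integral_const_mul, e]
  exact sum_mul_tensor_le D (S i) (S k) K h1 h2 ⟨fun q => ((q.1.1, q.2.1), (q.1.2, q.2.2)),
    fun q => ((q.1.1, q.2.1), (q.1.2, q.2.2)), fun _ => rfl, fun _ => rfl⟩

lemma degenerate_bilin {i k : ι} (hik : i ≠ k) {D : Matrix (Fin p) (Fin p) ℝ} {K : ℝ}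
    (h1 : frobSq D * frobSq (S i) ≤ K) (h2 : frobSq D * frobSq (S k) ≤ K) :
    Degenerate (fun i => multivariateGaussian 0 (S i)) {i, k}
      (fun ω => bilin D (ω i) (ω k)) K := by
  refine ⟨SqBound.bilin_pair hS hik h1 h2, fun j hj ω x => ?_, fun j hj ω => ?_⟩
  · simp only [Finset.mem_insert, Finset.mem_singleton, not_or] at hj
    rw [update_of_ne (Ne.symm hj.1), update_of_ne (Ne.symm hj.2)]
  · simp only [Finset.mem_insert, Finset.mem_singleton] at hj
    rcases hj with rfl | rfl
    · simp only [update_self, update_of_ne hik.symm, integral_bilin_left]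
    · simp only [update_self, update_of_ne hik, integral_bilin_right]

lemma degenerate_sqKernel {i j : ι} (hij : i ≠ j) :
    Degenerate (fun i => multivariateGaussian 0 (S i)) {i, j} (sqKernel S i j)
      (110 * (frobSq (S i) * frobSq (S j))) := by
  have hconst : SqBound (Measure.pi fun i => multivariateGaussian 0 (S i))
      (fun _ => frobInner (S i) (S j)) (frobSq (S i) * frobSq (S j)) := by
    refine ⟨HasMoments.const _, ?_⟩
    simpa using frobInner_sq_le (S i) (S j)
  have hmom : ∀ (D M : Matrix (Fin p) (Fin p) ℝ),
      HasMoments (multivariateGaussian 0 M) fun x => bilin D x x := fun D M => by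
    unfold bilin; fun_prop
  have hmom' : ∀ (z : EuclideanSpace ℝ (Fin p)) (M : Matrix (Fin p) (Fin p) ℝ),
      HasMoments (multivariateGaussian 0 M) fun x => inner ℝ x z := fun z M => by
    simp only [inner_eq_sum]; fun_prop
  refine ⟨((((SqBound.inner_sq hS hij).sub (SqBound.comp_eval
    (SqBound.bilin_self (hS i) (S j)))).sub (SqBound.comp_eval
    (SqBound.bilin_self (hS j) (S i)))).add hconst).mono (le_of_eq (by ring)),
    fun k hk ω x => ?_, fun k hk ω => ?_⟩
  · simp only [Finset.mem_insert, Finset.mem_singleton, not_or] at hk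
    simp only [sqKernel]
    rw [update_of_ne (Ne.symm hk.1), update_of_ne (Ne.symm hk.2)]
  · simp only [Finset.mem_insert, Finset.mem_singleton] at hk
    -- by symmetry it is enough to integrate in one of the two variables
    have key : ∀ (M N : Matrix (Fin p) (Fin p) ℝ) (z : EuclideanSpace ℝ (Fin p)),
        M.PosSemidef → ∫ x, (inner ℝ x z ^ 2 - bilin N x x - bilin M z z + frobInner M N)
          ∂multivariateGaussian 0 M = 0 := by
      intro M N z hM
      have h1 := hmom N M
      have h2 := hmom' z M
      rw [integral_add (HasMoments.integrable (by fun_prop)) (HasMoments.integrable (by fun_prop)),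
        integral_sub (HasMoments.integrable (by fun_prop)) (HasMoments.integrable (by fun_prop)),
        integral_sub (HasMoments.integrable (by fun_prop)) (HasMoments.integrable (by fun_prop)),
        integral_inner_sq hM, integral_bilin_self hM, frobInner_comm N M]
      simp
    rcases hk with rfl | rfl
    · simp only [sqKernel, update_self, update_of_ne hij.symm]
      exact key _ _ _ (hS k)
    · simp only [sqKernel, update_self, update_of_ne hij]
      rw [← key (S k) (S i) (ω i) (hS k)]
      refine integral_congr_ae (ae_of_all _ fun x => ?_)
      simp only [real_inner_comm x, frobInner_comm (S i)]
      ring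

lemma degenerate_pathKernel {i j k : ι} (hij : i ≠ j) (hjk : j ≠ k) (hik : i ≠ k) {K : ℝ}
    (h1 : frobSq (S i) * frobSq (S j) ≤ K) (h2 : frobSq (S j) * frobSq (S k) ≤ K) :
    Degenerate (fun i => multivariateGaussian 0 (S i)) {i, j, k} (pathKernel S i j k)
      (20 * K) := by
  have hmom : ∀ (z : EuclideanSpace ℝ (Fin p)) (M : Matrix (Fin p) (Fin p) ℝ),
      HasMoments (multivariateGaussian 0 M) fun x => inner ℝ x z := fun z M => by
    simp only [inner_eq_sum]; fun_prop
  have hmom' : ∀ (z : EuclideanSpace ℝ (Fin p)) (M : Matrix (Fin p) (Fin p) ℝ),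
      HasMoments (multivariateGaussian 0 M) fun x => inner ℝ z x := fun z M => by
    simp only [inner_eq_sum]; fun_prop
  have hmom2 : ∀ (z : EuclideanSpace ℝ (Fin p)) (D M : Matrix (Fin p) (Fin p) ℝ),
      HasMoments (multivariateGaussian 0 M) fun x => bilin D x z := fun z D M => by
    unfold bilin; fun_prop
  have hmom2' : ∀ (z : EuclideanSpace ℝ (Fin p)) (D M : Matrix (Fin p) (Fin p) ℝ),
      HasMoments (multivariateGaussian 0 M) fun x => bilin D z x := fun z D M => by
    unfold bilin; fun_prop
  refine ⟨((SqBound.inner_mul_inner hS hij hjk h1 h2).sub (SqBound.bilin_pair hS hik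
    (by linarith [mul_comm (frobSq (S i)) (frobSq (S j))]) h2)).mono (le_of_eq (by ring)),
    fun l hl ω x => ?_, fun l hl ω => ?_⟩
  · simp only [Finset.mem_insert, Finset.mem_singleton, not_or] at hl
    simp only [pathKernel]
    rw [update_of_ne (Ne.symm hl.1), update_of_ne (Ne.symm hl.2.1), update_of_ne (Ne.symm hl.2.2)]
  · simp only [Finset.mem_insert, Finset.mem_singleton] at hl
    rcases hl with rfl | rfl | rfl
    · simp only [pathKernel, update_self, update_of_ne hij.symm, update_of_ne hik.symm]
      rw [integral_sub ((hmom _ _).mul (HasMoments.const _)).integrable (hmom2 _ _ _).integrable,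
        integral_mul_const, integral_inner_left, integral_bilin_left]
      simp
    · simp only [pathKernel, update_self, update_of_ne hij, update_of_ne hjk.symm]
      rw [integral_sub ((hmom' _ _).mul (hmom _ _)).integrable (HasMoments.const _).integrable,
        integral_inner_mul_inner (hS l)]
      simp
    · simp only [pathKernel, update_self, update_of_ne hik, update_of_ne hjk]
      rw [integral_sub ((HasMoments.const _).mul (hmom' _ _)).integrable
        (hmom2' _ _ _).integrable, integral_const_mul, integral_inner_right, integral_bilin_right]
      simp

/-- The kernel `x_i' x_j x_k' x_l`. -/
lemma degenerate_inner_mul_inner {i j k l : ι} (hij : i ≠ j) (hkl : k ≠ l) (hik : i ≠ k)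
    (hil : i ≠ l) (hjk : j ≠ k) (hjl : j ≠ l) {K : ℝ}
    (h1 : frobSq (S i) * frobSq (S j) ≤ K) (h2 : frobSq (S k) * frobSq (S l) ≤ K) :
    Degenerate (fun i => multivariateGaussian 0 (S i)) {i, j, k, l}
      (fun ω => inner ℝ (ω i) (ω j) * inner ℝ (ω k) (ω l)) (9 * K) := by
  refine ⟨SqBound.inner_mul_inner hS hij hkl h1 h2, fun m hm ω x => ?_, fun m hm ω => ?_⟩
  · simp only [Finset.mem_insert, Finset.mem_singleton, not_or] at hm
    rw [update_of_ne (Ne.symm hm.1), update_of_ne (Ne.symm hm.2.1),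
      update_of_ne (Ne.symm hm.2.2.1), update_of_ne (Ne.symm hm.2.2.2)]
  · simp only [Finset.mem_insert, Finset.mem_singleton] at hm
    rcases hm with rfl | rfl | rfl | rfl
    · simp only [update_self, update_of_ne hij.symm, update_of_ne hik.symm, update_of_ne hil.symm]
      rw [integral_mul_const, integral_inner_left, zero_mul]
    · simp only [update_self, update_of_ne hij, update_of_ne hjk.symm, update_of_ne hjl.symm]
      rw [integral_mul_const, integral_inner_right, zero_mul]
    · simp only [update_self, update_of_ne hik, update_of_ne hjk, update_of_ne hkl.symm]
      rw [integral_const_mul, integral_inner_left, mul_zero]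
    · simp only [update_self, update_of_ne hil, update_of_ne hjl, update_of_ne hkl]
      rw [integral_const_mul, integral_inner_right, mul_zero]

end Kernels

/-! ### Decomposition of the trace estimators -/

section Decomposition

open Function

variable {ι : Type*} [DecidableEq ι] {p : ℕ} {S : ι → Matrix (Fin p) (Fin p) ℝ}

/-- The number of index tuples with a given set of variables, when a tuple is determined by `m` of
these variables and an element of `V`. -/
lemma card_filter_supp_eq_le {J V : Type*} [Fintype J] [Fintype V] [DecidableEq V] {m : ℕ}
    (τ : J → Fin m → ι) (ρ : J → V) (hinj : Injective fun b => (τ b, ρ b)) (supp : J → Finset ι)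
    (hmem : ∀ b i, τ b i ∈ supp b) (hcard : ∀ a, (supp a).card ≤ m) (a : J) :
    (Finset.univ.filter fun b => supp b = supp a).card ≤ m ^ m * Fintype.card V := by
  calc _ ≤ ((Fintype.piFinset fun _ : Fin m => supp a) ×ˢ (Finset.univ : Finset V)).card := by
        refine Finset.card_le_card_of_injOn (fun b => (τ b, ρ b)) (fun b hb => ?_) hinj.injOn
        have hb' : supp b = supp a := by simpa using hb
        simp only [Finset.coe_product, Set.mem_prod, Finset.mem_coe, Fintype.mem_piFinset,
          Finset.mem_univ, and_true]
        exact fun i => hb' ▸ hmem b i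
    _ = (supp a).card ^ m * Fintype.card V := by simp [Finset.card_product]
    _ ≤ _ := Nat.mul_le_mul_right _ (Nat.pow_le_pow_left (hcard a) m)

variable [Fintype ι]

/-- Second moment of the average of a family of degenerate kernels. -/
lemma SqBound.average_degenerate {μ : ι → Measure (EuclideanSpace ℝ (Fin p))}
    [∀ i, IsProbabilityMeasure (μ i)] {J : Type*} [Fintype J] {supp : J → Finset ι}
    {W : J → (ι → EuclideanSpace ℝ (Fin p)) → ℝ} {K : ℝ}
    (h : ∀ a, Degenerate μ (supp a) (W a) K) {N : ℕ}
    (hN : ∀ a, (Finset.univ.filter fun b => supp b = supp a).card ≤ N) {c d : ℝ}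
    (hd : (Fintype.card J : ℝ) = d) (hd0 : 0 < d) (hc : c = 1 / d) :
    SqBound (Measure.pi μ) (fun ω => c * ∑ a, W a ω) (N * K / d) := by
  refine ((SqBound.sum_degenerate h hN).const_mul c).mono (le_of_eq ?_)
  rw [hd, hc]
  field_simp

/-- Each index occurs in each position of `n - 1` ordered pairs of distinct indices. -/
lemma sum_embedding_two {n : ℕ} (f : Fin n → ℝ) :
    ∑ e : Fin 2 ↪ Fin n, (f (e 0) + f (e 1)) = 2 * ((n : ℝ) - 1) * ∑ u, f u := by
  have h : ∀ g : Fin n → Fin n → ℝ, ∑ e : Fin 2 ↪ Fin n, g (e 0) (e 1) =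
      ∑ u, ∑ v, if u = v then 0 else g u v := by
    intro g
    rw [← Fintype.sum_prod_type' fun u v => if u = v then 0 else g u v]
    simp only [Finset.sum_ite, Finset.sum_const_zero, zero_add]
    refine Finset.sum_bij (fun e _ => (e 0, e 1)) ?_ ?_ ?_ ?_
    · intro e _
      simp
    · intro e _ e' _ h
      ext i
      fin_cases i <;> simp_all
    · rintro ⟨u, v⟩ huv
      have huv : u ≠ v := by simpa using huv
      have hinj : Injective ![u, v] := by
        intro i j hij
        fin_cases i <;> fin_cases j <;> simp_all
      exact ⟨⟨![u, v], hinj⟩, Finset.mem_univ _, by simp⟩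
    · intro e _
      rfl
  rw [h fun u v => f u + f v]
  have e : ∀ u v : Fin n, (if u = v then 0 else f u + f v) =
      f u + f v - if u = v then f u + f v else 0 := fun u v => by split_ifs <;> ring
  simp only [e, Finset.sum_sub_distrib, Finset.sum_add_distrib, Finset.sum_ite_eq,
    Finset.sum_const, Finset.mem_univ, if_true, Finset.card_univ, Fintype.card_fin, nsmul_eq_mul,
    ← Finset.mul_sum]
  ring

lemma card_embedding_two {n : ℕ} (hn : 4 ≤ n) :
    (Fintype.card (Fin 2 ↪ Fin n) : ℝ) = (n : ℝ) * (n - 1) := by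
  obtain ⟨m, rfl⟩ := Nat.exists_eq_add_of_le' hn
  simp [Fintype.card_embedding_eq, Nat.descFactorial_succ]
  ring

lemma card_embedding_three {n : ℕ} (hn : 4 ≤ n) :
    (Fintype.card (Fin 3 ↪ Fin n) : ℝ) = (n : ℝ) * (n - 1) * (n - 2) := by
  obtain ⟨m, rfl⟩ := Nat.exists_eq_add_of_le' hn
  simp [Fintype.card_embedding_eq, Nat.descFactorial_succ]
  ring

lemma card_embedding_four {n : ℕ} (hn : 4 ≤ n) :
    (Fintype.card (Fin 4 ↪ Fin n) : ℝ) = (n : ℝ) * (n - 1) * (n - 2) * (n - 3) := by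
  obtain ⟨m, rfl⟩ := Nat.exists_eq_add_of_le' hn
  simp [Fintype.card_embedding_eq, Nat.descFactorial_succ]
  ring

lemma frobInner_self (M : Matrix (Fin p) (Fin p) ℝ) : frobInner M M = frobSq M := by
  simp only [frobInner, frobSq, sq]

/-- The estimator of `tr (Σ²)` is the sum of its target, a linear term, and a remainder of smaller
order made of degenerate `U`-statistics. -/
lemma exists_traceSqEst_eq (hS : ∀ i, (S i).PosSemidef) {n : ℕ} (hn : 4 ≤ n) (φ : Fin n ↪ ι)
    {M : Matrix (Fin p) (Fin p) ℝ} (hM : ∀ u, S (φ u) = M) :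
    ∃ R, SqBound (Measure.pi fun i => multivariateGaussian 0 (S i)) R
        (26000 * (frobSq M ^ 2 / (n : ℝ) ^ 2)) ∧
      ∀ ω, traceSqEst (fun u => ω (φ u)) = frobSq M +
        2 / (n : ℝ) * ∑ u, (bilin M (ω (φ u)) (ω (φ u)) - frobSq M) + R ω := by
  have hn' : (4 : ℝ) ≤ n := by exact_mod_cast hn
  have hne : ∀ {m : ℕ} (e : Fin m ↪ Fin n) {i j : Fin m}, i ≠ j → φ (e i) ≠ φ (e j) :=
    fun e i j h h' => h (e.injective (φ.injective h'))
  have hF : ∀ u v, frobSq (S (φ u)) * frobSq (S (φ v)) = frobSq M ^ 2 := fun u v => by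
    rw [hM, hM, sq]
  have hFM : ∀ u, frobSq M * frobSq (S (φ u)) = frobSq M ^ 2 := fun u => by rw [hM, sq]
  have hinj : ∀ m : ℕ, Injective fun b : Fin m ↪ Fin n => (fun i => φ (b i), ()) := by
    intro m b c h
    simp only [Prod.mk.injEq, and_true] at h
    ext i
    exact congrArg Fin.val (φ.injective (congrFun h i))
  have h1 : (0 : ℝ) < n := by linarith
  have h2 : (0 : ℝ) < n - 1 := by linarith
  have h3 : (0 : ℝ) < n - 2 := by linarith
  have h4 : (0 : ℝ) < n - 3 := by linarith
  have c2 : 1 / ((n : ℝ) * (n - 1)) ≤ 2 / (n : ℝ) ^ 2 := by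
    rw [div_le_div_iff₀ (by positivity) (by positivity)]
    nlinarith
  have c2' : 1 / (((n : ℝ) - 1) * (n - 2)) ≤ 4 / (n : ℝ) ^ 2 := by
    rw [div_le_div_iff₀ (by positivity) (by positivity)]
    nlinarith
  have c3 : 1 / ((n : ℝ) * (n - 1) * (n - 2)) ≤ 1 / (n : ℝ) ^ 2 := by
    refine one_div_le_one_div_of_le (by positivity) ?_
    have : (n : ℝ) ≤ (n - 1) * (n - 2) := by nlinarith
    nlinarith
  have c4 : 1 / ((n : ℝ) * (n - 1) * (n - 2) * (n - 3)) ≤ 1 / (n : ℝ) ^ 2 := by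
    refine one_div_le_one_div_of_le (by positivity) ?_
    have h5 : (n : ℝ) ≤ (n - 1) * (n - 2) := by nlinarith
    have h6 : (n : ℝ) * n ≤ n * (n - 1) * (n - 2) := by nlinarith
    nlinarith
  have d1 : ∀ e : Fin 2 ↪ Fin n, Degenerate (fun i => multivariateGaussian 0 (S i))
      {φ (e 0), φ (e 1)} (sqKernel S (φ (e 0)) (φ (e 1))) (110 * frobSq M ^ 2) := by
    intro e
    have := degenerate_sqKernel hS (hne e (i := 0) (j := 1) (by decide))
    rwa [hF] at this
  have d2 : ∀ e : Fin 3 ↪ Fin n, Degenerate (fun i => multivariateGaussian 0 (S i))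
      {φ (e 0), φ (e 1), φ (e 2)} (pathKernel S (φ (e 0)) (φ (e 1)) (φ (e 2)))
      (20 * frobSq M ^ 2) := fun e =>
    degenerate_pathKernel hS (hne e (by decide)) (hne e (by decide)) (hne e (by decide))
      (hF _ _).le (hF _ _).le
  have d3 : ∀ e : Fin 3 ↪ Fin n, Degenerate (fun i => multivariateGaussian 0 (S i))
      {φ (e 0), φ (e 2)} (fun ω => bilin M (ω (φ (e 0))) (ω (φ (e 2)))) (frobSq M ^ 2) := fun e =>
    degenerate_bilin hS (hne e (by decide)) (hFM _).le (hFM _).le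
  have d4 : ∀ e : Fin 4 ↪ Fin n, Degenerate (fun i => multivariateGaussian 0 (S i))
      {φ (e 0), φ (e 1), φ (e 2), φ (e 3)}
      (fun ω => inner ℝ (ω (φ (e 0))) (ω (φ (e 1))) * inner ℝ (ω (φ (e 2))) (ω (φ (e 3))))
      (9 * frobSq M ^ 2) := fun e =>
    degenerate_inner_mul_inner hS (hne e (by decide)) (hne e (by decide)) (hne e (by decide))
      (hne e (by decide)) (hne e (by decide)) (hne e (by decide)) (hF _ _).le (hF _ _).le
  have b1 := SqBound.average_degenerate d1 (N := 4)
    (fun a => (card_filter_supp_eq_le (fun e i => φ (e i)) _ (hinj 2) _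
      (fun b i => by fin_cases i <;> simp) (fun a => Finset.card_le_two) a).trans (by simp))
    (card_embedding_two hn) (by positivity) rfl
  have b2 := SqBound.average_degenerate d2 (N := 27)
    (fun a => (card_filter_supp_eq_le (fun e i => φ (e i)) _ (hinj 3) _
      (fun b i => by fin_cases i <;> simp) (fun a => Finset.card_le_three) a).trans (by simp))
    (card_embedding_three hn) (by positivity) rfl
  -- the kernel does not depend on the middle index, which is therefore free
  have b3 := SqBound.average_degenerate d3 (N := 4 * n)
    (fun a => (card_filter_supp_eq_le (fun e => ![φ (e 0), φ (e 2)]) (fun e => e 1)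
      (by
        intro b c h
        simp only [Prod.mk.injEq, Matrix.vecCons_inj, φ.injective.eq_iff] at h
        ext i
        fin_cases i <;> simp [h]) _
      (fun b i => by fin_cases i <;> simp) (fun a => Finset.card_le_two) a).trans (by simp))
    (card_embedding_three hn) (by positivity) rfl
  have b4 := SqBound.average_degenerate d4 (N := 256)
    (fun a => (card_filter_supp_eq_le (fun e i => φ (e i)) _ (hinj 4) _
      (fun b i => by fin_cases i <;> simp) (fun a => Finset.card_le_four) a).trans (by simp))
    (card_embedding_four hn) (by positivity) rfl
  refine ⟨_, ((b1.sub ((b2.add b3).const_mul 2)).add b4).mono ?_, fun ω => ?_⟩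
  · have hF0 : 0 ≤ frobSq M ^ 2 := sq_nonneg _
    have e1 := mul_le_mul_of_nonneg_left c2 hF0
    have e2 := mul_le_mul_of_nonneg_left c3 hF0
    have e3 := mul_le_mul_of_nonneg_left c2' hF0
    have e4 := mul_le_mul_of_nonneg_left c4 hF0
    have e3' : ((4 * n : ℕ) : ℝ) * frobSq M ^ 2 / ((n : ℝ) * (n - 1) * (n - 2)) =
        4 * (frobSq M ^ 2 * (1 / (((n : ℝ) - 1) * (n - 2)))) := by
      push_cast
      field_simp
    have e5 : 0 ≤ frobSq M ^ 2 * (1 / (n : ℝ) ^ 2) := by positivity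
    rw [e3']
    push_cast
    simp only [div_eq_mul_inv] at *
    linarith
  · have hsq : ∀ e : Fin 2 ↪ Fin n, inner ℝ (ω (φ (e 0))) (ω (φ (e 1))) ^ 2 =
        sqKernel S (φ (e 0)) (φ (e 1)) ω + ((bilin M (ω (φ (e 0))) (ω (φ (e 0))) - frobSq M) +
          (bilin M (ω (φ (e 1))) (ω (φ (e 1))) - frobSq M)) + frobSq M := by
      intro e
      simp only [sqKernel, hM, frobInner_self]
      ring
    have hpath : ∀ e : Fin 3 ↪ Fin n,
        inner ℝ (ω (φ (e 0))) (ω (φ (e 1))) * inner ℝ (ω (φ (e 1))) (ω (φ (e 2))) =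
        pathKernel S (φ (e 0)) (φ (e 1)) (φ (e 2)) ω + bilin M (ω (φ (e 0))) (ω (φ (e 2))) := by
      intro e
      simp only [pathKernel, hM]
      ring
    simp only [traceSqEst, hsq, hpath, Finset.sum_add_distrib (s := Finset.univ)
      (f := fun e : Fin 3 ↪ Fin n => pathKernel S (φ (e 0)) (φ (e 1)) (φ (e 2)) ω)]
    rw [Finset.sum_add_distrib, Finset.sum_add_distrib,
      sum_embedding_two fun u => bilin M (ω (φ u)) (ω (φ u)) - frobSq M, Finset.sum_const,
      Finset.card_univ, nsmul_eq_mul, card_embedding_two hn]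
    field_simp
    ring

end Decomposition

/-! ### Decomposition of the cross estimator -/

section CrossDecomposition

open Function

variable {ι : Type*} [DecidableEq ι] [Fintype ι] {p : ℕ} {S : ι → Matrix (Fin p) (Fin p) ℝ}

/-- The estimator of `tr (Σ₁ Σ₂)` is the sum of its target, two linear terms, and a remainder of
smaller order made of degenerate kernels. -/
lemma exists_traceMulEst_eq (hS : ∀ i, (S i).PosSemidef) {n₁ n₂ : ℕ} (hn₁ : 4 ≤ n₁) (hn₂ : 4 ≤ n₂)
    (φ : Fin n₁ ↪ ι) (ψ : Fin n₂ ↪ ι) (hφψ : ∀ u v, φ u ≠ ψ v) {M N : Matrix (Fin p) (Fin p) ℝ}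
    (hM : ∀ u, S (φ u) = M) (hN : ∀ v, S (ψ v) = N) :
    ∃ R, SqBound (Measure.pi fun i => multivariateGaussian 0 (S i)) R
        (11000 * (frobSq M * frobSq N * (1 / (n₁ : ℝ) ^ 2 + 1 / (n₂ : ℝ) ^ 2))) ∧
      ∀ ω, traceMulEst (fun u => ω (φ u)) (fun v => ω (ψ v)) = frobInner M N +
        1 / (n₁ : ℝ) * ∑ u, (bilin N (ω (φ u)) (ω (φ u)) - frobInner M N) +
        1 / (n₂ : ℝ) * ∑ v, (bilin M (ω (ψ v)) (ω (ψ v)) - frobInner M N) + R ω := by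
  have hn₁' : (4 : ℝ) ≤ n₁ := by exact_mod_cast hn₁
  have hn₂' : (4 : ℝ) ≤ n₂ := by exact_mod_cast hn₂
  have hφ : ∀ (e : Fin 2 ↪ Fin n₁), φ (e 0) ≠ φ (e 1) :=
    fun e h => absurd (e.injective (φ.injective h)) (by decide)
  have hψ : ∀ (e : Fin 2 ↪ Fin n₂), ψ (e 0) ≠ ψ (e 1) :=
    fun e h => absurd (e.injective (ψ.injective h)) (by decide)
  have hψφ : ∀ v u, ψ v ≠ φ u := fun v u => (hφψ u v).symm
  set K := frobSq M * frobSq N with hK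
  have hK0 : 0 ≤ K := mul_nonneg (frobSq_nonneg M) (frobSq_nonneg N)
  have hF : ∀ u v, frobSq (S (φ u)) * frobSq (S (ψ v)) = K := fun u v => by rw [hM, hN]
  have hF' : ∀ v u, frobSq (S (ψ v)) * frobSq (S (φ u)) = K := fun v u => by
    rw [hM, hN, mul_comm]
  have hFN : ∀ u, frobSq N * frobSq (S (φ u)) = K := fun u => by rw [hM, mul_comm]
  have hFM : ∀ v, frobSq M * frobSq (S (ψ v)) = K := fun v => by rw [hN]
  have h1 : (0 : ℝ) < n₁ := by linarith
  have h1' : (0 : ℝ) < n₁ - 1 := by linarith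
  have h2 : (0 : ℝ) < n₂ := by linarith
  have h2' : (0 : ℝ) < n₂ - 1 := by linarith
  have d1 : ∀ e : Fin n₁ × Fin n₂, Degenerate (fun i => multivariateGaussian 0 (S i))
      {φ e.1, ψ e.2} (sqKernel S (φ e.1) (ψ e.2)) (110 * K) := by
    intro e
    have := degenerate_sqKernel hS (hφψ e.1 e.2)
    rwa [hF] at this
  have d2 : ∀ e : (Fin 2 ↪ Fin n₁) × Fin n₂, Degenerate (fun i => multivariateGaussian 0 (S i))
      {φ (e.1 0), ψ e.2, φ (e.1 1)} (pathKernel S (φ (e.1 0)) (ψ e.2) (φ (e.1 1)))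
      (20 * K) := fun e =>
    degenerate_pathKernel hS (hφψ _ _) (hψφ _ _) (hφ _) (hF _ _).le (hF' _ _).le
  have d3 : ∀ e : (Fin 2 ↪ Fin n₁) × Fin n₂, Degenerate (fun i => multivariateGaussian 0 (S i))
      {φ (e.1 0), φ (e.1 1)} (fun ω => bilin N (ω (φ (e.1 0))) (ω (φ (e.1 1)))) K := fun e =>
    degenerate_bilin hS (hφ _) (hFN _).le (hFN _).le
  have d2' : ∀ e : (Fin 2 ↪ Fin n₂) × Fin n₁, Degenerate (fun i => multivariateGaussian 0 (S i))
      {ψ (e.1 0), φ e.2, ψ (e.1 1)} (pathKernel S (ψ (e.1 0)) (φ e.2) (ψ (e.1 1)))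
      (20 * K) := fun e =>
    degenerate_pathKernel hS (hψφ _ _) (hφψ _ _) (hψ _) (hF' _ _).le (hF _ _).le
  have d3' : ∀ e : (Fin 2 ↪ Fin n₂) × Fin n₁, Degenerate (fun i => multivariateGaussian 0 (S i))
      {ψ (e.1 0), ψ (e.1 1)} (fun ω => bilin M (ω (ψ (e.1 0))) (ω (ψ (e.1 1)))) K := fun e =>
    degenerate_bilin hS (hψ _) (hFM _).le (hFM _).le
  have d4 : ∀ e : (Fin 2 ↪ Fin n₁) × (Fin 2 ↪ Fin n₂),
      Degenerate (fun i => multivariateGaussian 0 (S i))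
      {φ (e.1 0), ψ (e.2 0), φ (e.1 1), ψ (e.2 1)}
      (fun ω => inner ℝ (ω (φ (e.1 0))) (ω (ψ (e.2 0))) * inner ℝ (ω (φ (e.1 1))) (ω (ψ (e.2 1))))
      (9 * K) := fun e =>
    degenerate_inner_mul_inner hS (hφψ _ _) (hφψ _ _) (hφ _) (hφψ _ _) (hψφ _ _) (hψ _)
      (hF _ _).le (hF _ _).le
  have b1 := SqBound.average_degenerate d1 (N := 4) (d := (n₁ : ℝ) * n₂)
    (fun a => (card_filter_supp_eq_le (fun e => ![φ e.1, ψ e.2]) (fun _ => ())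
      (by
        intro b c h
        simp only [Prod.mk.injEq, Matrix.vecCons_inj, φ.injective.eq_iff, ψ.injective.eq_iff] at h
        exact Prod.ext h.1.1 h.1.2.1) _
      (fun b i => by fin_cases i <;> simp) (fun a => Finset.card_le_two) a).trans (by simp))
    (by simp) (by positivity) rfl
  have b2 := SqBound.average_degenerate d2 (N := 27) (d := (n₁ : ℝ) * n₂ * (n₁ - 1))
    (fun a => (card_filter_supp_eq_le (fun e => ![φ (e.1 0), ψ e.2, φ (e.1 1)]) (fun _ => ())
      (by
        intro b c h
        simp only [Prod.mk.injEq, Matrix.vecCons_inj, φ.injective.eq_iff, ψ.injective.eq_iff] at h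
        refine Prod.ext (Embedding.ext fun i => ?_) h.1.2.1
        fin_cases i <;> simp [h]) _
      (fun b i => by fin_cases i <;> simp) (fun a => Finset.card_le_three) a).trans (by simp))
    (by rw [Fintype.card_prod, Nat.cast_mul, card_embedding_two hn₁, Fintype.card_fin]; ring)
    (by positivity) rfl
  have b3 := SqBound.average_degenerate d3 (N := 4 * n₂) (d := (n₁ : ℝ) * n₂ * (n₁ - 1))
    (fun a => (card_filter_supp_eq_le (fun e => ![φ (e.1 0), φ (e.1 1)]) (fun e => e.2)
      (by
        intro b c h
        simp only [Prod.mk.injEq, Matrix.vecCons_inj, φ.injective.eq_iff] at h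
        refine Prod.ext (Embedding.ext fun i => ?_) h.2
        fin_cases i <;> simp [h]) _
      (fun b i => by fin_cases i <;> simp) (fun a => Finset.card_le_two) a).trans (by simp))
    (by rw [Fintype.card_prod, Nat.cast_mul, card_embedding_two hn₁, Fintype.card_fin]; ring)
    (by positivity) rfl
  have b2' := SqBound.average_degenerate d2' (N := 27) (d := (n₁ : ℝ) * n₂ * (n₂ - 1))
    (fun a => (card_filter_supp_eq_le (fun e => ![ψ (e.1 0), φ e.2, ψ (e.1 1)]) (fun _ => ())
      (by
        intro b c h
        simp only [Prod.mk.injEq, Matrix.vecCons_inj, φ.injective.eq_iff, ψ.injective.eq_iff] at h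
        refine Prod.ext (Embedding.ext fun i => ?_) h.1.2.1
        fin_cases i <;> simp [h]) _
      (fun b i => by fin_cases i <;> simp) (fun a => Finset.card_le_three) a).trans (by simp))
    (by rw [Fintype.card_prod, Nat.cast_mul, card_embedding_two hn₂, Fintype.card_fin]; ring)
    (by positivity) rfl
  have b3' := SqBound.average_degenerate d3' (N := 4 * n₁) (d := (n₁ : ℝ) * n₂ * (n₂ - 1))
    (fun a => (card_filter_supp_eq_le (fun e => ![ψ (e.1 0), ψ (e.1 1)]) (fun e => e.2)
      (by
        intro b c h
        simp only [Prod.mk.injEq, Matrix.vecCons_inj, ψ.injective.eq_iff] at h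
        refine Prod.ext (Embedding.ext fun i => ?_) h.2
        fin_cases i <;> simp [h]) _
      (fun b i => by fin_cases i <;> simp) (fun a => Finset.card_le_two) a).trans (by simp))
    (by rw [Fintype.card_prod, Nat.cast_mul, card_embedding_two hn₂, Fintype.card_fin]; ring)
    (by positivity) rfl
  have b4 := SqBound.average_degenerate d4 (N := 256)
    (d := (n₁ : ℝ) * n₂ * (n₁ - 1) * (n₂ - 1))
    (fun a => (card_filter_supp_eq_le
      (fun e => ![φ (e.1 0), ψ (e.2 0), φ (e.1 1), ψ (e.2 1)]) (fun _ => ())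
      (by
        intro b c h
        simp only [Prod.mk.injEq, Matrix.vecCons_inj, φ.injective.eq_iff, ψ.injective.eq_iff] at h
        refine Prod.ext (Embedding.ext fun i => ?_) (Embedding.ext fun i => ?_) <;>
          fin_cases i <;> simp [h]) _
      (fun b i => by fin_cases i <;> simp) (fun a => Finset.card_le_four) a).trans (by simp))
    (by
      rw [Fintype.card_prod, Nat.cast_mul, card_embedding_two hn₁, card_embedding_two hn₂]
      ring)
    (by positivity) rfl
  refine ⟨_, (((b1.sub (b2.add b3)).sub (b2'.add b3')).add b4).mono ?_, fun ω => ?_⟩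
  -- every term is `O(K (1 / n₁² + 1 / n₂²))`, mostly through `1 / (n₁ n₂)`
  · have c1 : 1 / ((n₁ : ℝ) * n₂) ≤ (1 / 2) * (1 / (n₁ : ℝ) ^ 2 + 1 / (n₂ : ℝ) ^ 2) := by
      have := sq_nonneg (1 / (n₁ : ℝ) - 1 / n₂)
      have e : (1 / (n₁ : ℝ) - 1 / n₂) ^ 2 =
          1 / (n₁ : ℝ) ^ 2 + 1 / (n₂ : ℝ) ^ 2 - 2 * (1 / ((n₁ : ℝ) * n₂)) := by
        field_simp
        ring
      linarith
    have hpos : (0 : ℝ) < n₁ * n₂ := by positivity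
    have c2 : 1 / ((n₁ : ℝ) * n₂ * (n₁ - 1)) ≤ 1 / ((n₁ : ℝ) * n₂) :=
      one_div_le_one_div_of_le (by positivity) (by nlinarith)
    have c2' : 1 / ((n₁ : ℝ) * n₂ * (n₂ - 1)) ≤ 1 / ((n₁ : ℝ) * n₂) :=
      one_div_le_one_div_of_le (by positivity) (by nlinarith)
    have c4 : 1 / ((n₁ : ℝ) * n₂ * (n₁ - 1) * (n₂ - 1)) ≤ 1 / ((n₁ : ℝ) * n₂) := by
      refine one_div_le_one_div_of_le (by positivity) ?_
      have : (n₁ : ℝ) * n₂ ≤ n₁ * n₂ * (n₁ - 1) := by nlinarith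
      nlinarith
    have c3 : 1 / ((n₁ : ℝ) * (n₁ - 1)) ≤ 2 * (1 / (n₁ : ℝ) ^ 2) := by
      rw [mul_one_div, div_le_div_iff₀ (by positivity) (by positivity)]
      nlinarith
    have c3' : 1 / ((n₂ : ℝ) * (n₂ - 1)) ≤ 2 * (1 / (n₂ : ℝ) ^ 2) := by
      rw [mul_one_div, div_le_div_iff₀ (by positivity) (by positivity)]
      nlinarith
    have e3 : ((4 * n₂ : ℕ) : ℝ) * K / ((n₁ : ℝ) * n₂ * (n₁ - 1)) =
        4 * (K * (1 / ((n₁ : ℝ) * (n₁ - 1)))) := by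
      push_cast
      field_simp
    have e3' : ((4 * n₁ : ℕ) : ℝ) * K / ((n₁ : ℝ) * n₂ * (n₂ - 1)) =
        4 * (K * (1 / ((n₂ : ℝ) * (n₂ - 1)))) := by
      push_cast
      field_simp
    have f1 := mul_le_mul_of_nonneg_left c1 hK0
    have f2 := mul_le_mul_of_nonneg_left c2 hK0
    have f2' := mul_le_mul_of_nonneg_left c2' hK0
    have f3 := mul_le_mul_of_nonneg_left c3 hK0
    have f3' := mul_le_mul_of_nonneg_left c3' hK0
    have f4 := mul_le_mul_of_nonneg_left c4 hK0
    have f5 : 0 ≤ K * (1 / (n₁ : ℝ) ^ 2) := by positivity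
    have f6 : 0 ≤ K * (1 / (n₂ : ℝ) ^ 2) := by positivity
    rw [e3, e3']
    clear_value K
    push_cast
    simp only [div_eq_mul_inv] at *
    linarith
  · have hsq : ∀ e : Fin n₁ × Fin n₂, inner ℝ (ω (φ e.1)) (ω (ψ e.2)) ^ 2 =
        sqKernel S (φ e.1) (ψ e.2) ω + (bilin N (ω (φ e.1)) (ω (φ e.1)) - frobInner M N) +
          (bilin M (ω (ψ e.2)) (ω (ψ e.2)) - frobInner M N) + frobInner M N := by
      intro e
      simp only [sqKernel, hM, hN]
      ring
    have hpath : ∀ e : (Fin 2 ↪ Fin n₁) × Fin n₂,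
        inner ℝ (ω (φ (e.1 0))) (ω (ψ e.2)) * inner ℝ (ω (ψ e.2)) (ω (φ (e.1 1))) =
        pathKernel S (φ (e.1 0)) (ψ e.2) (φ (e.1 1)) ω +
          bilin N (ω (φ (e.1 0))) (ω (φ (e.1 1))) := by
      intro e
      simp only [pathKernel, hN]
      ring
    have hpath' : ∀ e : (Fin 2 ↪ Fin n₂) × Fin n₁,
        inner ℝ (ω (ψ (e.1 0))) (ω (φ e.2)) * inner ℝ (ω (φ e.2)) (ω (ψ (e.1 1))) =
        pathKernel S (ψ (e.1 0)) (φ e.2) (ψ (e.1 1)) ω +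
          bilin M (ω (ψ (e.1 0))) (ω (ψ (e.1 1))) := by
      intro e
      simp only [pathKernel, hM]
      ring
    have s1 : ∑ u : Fin n₁, ∑ v : Fin n₂, inner ℝ (ω (φ u)) (ω (ψ v)) ^ 2 =
        ∑ e : Fin n₁ × Fin n₂, sqKernel S (φ e.1) (ψ e.2) ω +
        n₂ * ∑ u, (bilin N (ω (φ u)) (ω (φ u)) - frobInner M N) +
        n₁ * ∑ v, (bilin M (ω (ψ v)) (ω (ψ v)) - frobInner M N) + n₁ * n₂ * frobInner M N := by
      rw [← Fintype.sum_prod_type' fun u v => inner ℝ (ω (φ u)) (ω (ψ v)) ^ 2]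
      simp only [hsq]
      rw [Finset.sum_add_distrib, Finset.sum_add_distrib, Finset.sum_add_distrib,
        Fintype.sum_prod_type' fun u (_ : Fin n₂) => bilin N (ω (φ u)) (ω (φ u)) - frobInner M N,
        Fintype.sum_prod_type' fun (_ : Fin n₁) v => bilin M (ω (ψ v)) (ω (ψ v)) - frobInner M N]
      simp only [Finset.sum_const, Finset.card_univ, Fintype.card_fin, nsmul_eq_mul,
        Fintype.card_prod, Nat.cast_mul, ← Finset.mul_sum]
    have s4 := Fintype.sum_prod_type' fun (e : Fin 2 ↪ Fin n₁) (f : Fin 2 ↪ Fin n₂) =>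
      inner ℝ (ω (φ (e 0))) (ω (ψ (f 0))) * inner ℝ (ω (φ (e 1))) (ω (ψ (f 1)))
    simp only [traceMulEst]
    rw [s1, ← s4]
    simp only [← Fintype.sum_prod_type']
    simp only [hpath, hpath', Finset.sum_add_distrib]
    field_simp
    ring

end CrossDecomposition

/-! ### The quadratic form statistic under dense alternatives -/

section Dense

open Function

variable {p : ℕ}

lemma trace_sq_eq_frobSq {M : Matrix (Fin p) (Fin p) ℝ} (hM : M.IsHermitian) :
    (M ^ 2).trace = frobSq M := by
  simp only [sq M, Matrix.trace, Matrix.diag_apply, Matrix.mul_apply, frobSq]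
  refine Finset.sum_congr rfl fun a _ => Finset.sum_congr rfl fun b _ => ?_
  rw [show M b a = M a b by simpa using hM.apply a b, sq]

lemma frobSq_sub (M N : Matrix (Fin p) (Fin p) ℝ) :
    frobSq (M - N) = frobSq M + frobSq N - 2 * frobInner M N := by
  simp only [frobSq, frobInner, Finset.mul_sum, ← Finset.sum_add_distrib, ← Finset.sum_sub_distrib]
  refine Finset.sum_congr rfl fun a _ => Finset.sum_congr rfl fun b _ => ?_
  rw [Matrix.sub_apply]
  ring

lemma frobSq_sub_comm (M N : Matrix (Fin p) (Fin p) ℝ) : frobSq (M - N) = frobSq (N - M) := by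
  simp only [frobSq, Matrix.sub_apply]
  exact Finset.sum_congr rfl fun a _ => Finset.sum_congr rfl fun b _ => by ring

lemma frobInner_sub_left (M N L : Matrix (Fin p) (Fin p) ℝ) :
    frobInner (M - N) L = frobInner M L - frobInner N L := by
  simp only [frobInner, ← Finset.sum_sub_distrib, Matrix.sub_apply, sub_mul]

lemma bilin_sub (M N : Matrix (Fin p) (Fin p) ℝ) (x y : EuclideanSpace ℝ (Fin p)) :
    bilin (M - N) x y = bilin M x y - bilin N x y := by
  simp only [bilin, ← Finset.sum_sub_distrib, Matrix.sub_apply, sub_mul]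

variable {ι : Type*} [DecidableEq ι] [Fintype ι] {S : ι → Matrix (Fin p) (Fin p) ℝ}

/-- Second moment of a centred average of quadratic forms. -/
lemma SqBound.average_bilin (hS : ∀ i, (S i).PosSemidef) {n : ℕ} (hn : 0 < n) (φ : Fin n ↪ ι)
    {M : Matrix (Fin p) (Fin p) ℝ} (hM : ∀ u, S (φ u) = M) (D : Matrix (Fin p) (Fin p) ℝ) :
    SqBound (Measure.pi fun i => multivariateGaussian 0 (S i))
      (fun ω => 2 / (n : ℝ) * ∑ u, (bilin D (ω (φ u)) (ω (φ u)) - frobInner D M))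
      (12 * (frobSq D * frobSq M / n)) := by
  have hn' : (0 : ℝ) < n := by exact_mod_cast hn
  have hM' : M.PosSemidef := hM ⟨0, hn⟩ ▸ hS _
  have h1 := SqBound.bilin_self hM' D
  have h2 := h1.sub_integral (integral_bilin_self hM' D)
  have h3 := SqBound.sum_coordinates (μ := fun i => multivariateGaussian 0 (S i)) (φ := φ)
    (g := fun x => bilin D x x - frobInner D M) (K := 3 * (frobSq D * frobSq M))
    (fun u => by rw [hM]; exact h2) (fun u => by
      rw [hM, integral_sub h1.1.integrable (HasMoments.const _).integrable,
        integral_bilin_self hM']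
      simp)
  refine (h3.const_mul (2 / (n : ℝ))).mono (le_of_eq ?_)
  rw [Fintype.card_fin]
  field_simp
  ring

/-- The estimator of `tr (Σ²)` has relative error of order `n^(-1/2)`. -/
lemma SqBound.traceSqEst_sub (hS : ∀ i, (S i).PosSemidef) {n : ℕ} (hn : 4 ≤ n) (φ : Fin n ↪ ι)
    {M : Matrix (Fin p) (Fin p) ℝ} (hM : ∀ u, S (φ u) = M) :
    SqBound (Measure.pi fun i => multivariateGaussian 0 (S i))
      (fun ω => traceSqEst (fun u => ω (φ u)) - frobSq M) (60000 * (frobSq M ^ 2 / n)) := by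
  obtain ⟨R, hR, hA⟩ := exists_traceSqEst_eq hS hn φ hM
  have h1 := SqBound.average_bilin hS (by omega) φ hM M
  have e : (fun ω => traceSqEst (fun u => ω (φ u)) - frobSq M) = fun ω =>
      2 / (n : ℝ) * ∑ u, (bilin M (ω (φ u)) (ω (φ u)) - frobInner M M) + R ω := by
    ext ω
    rw [hA, frobInner_self]
    ring
  rw [e]
  refine (h1.add hR).mono ?_
  have hn' : (4 : ℝ) ≤ n := by exact_mod_cast hn
  have h2 : frobSq M ^ 2 / (n : ℝ) ^ 2 ≤ frobSq M ^ 2 / n :=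
    div_le_div_of_nonneg_left (sq_nonneg _) (by linarith) (by nlinarith)
  have h3 : 0 ≤ frobSq M ^ 2 / (n : ℝ) := by positivity
  rw [← sq]
  linarith

/-- The second moment of `T - tr ((Σ₁ - Σ₂)²)`. -/
lemma SqBound.quadStat_sub (hS : ∀ i, (S i).PosSemidef) {n₁ n₂ : ℕ} (hn₁ : 4 ≤ n₁) (hn₂ : 4 ≤ n₂)
    (φ : Fin n₁ ↪ ι) (ψ : Fin n₂ ↪ ι) (hφψ : ∀ u v, φ u ≠ ψ v) {M N : Matrix (Fin p) (Fin p) ℝ}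
    (hM : ∀ u, S (φ u) = M) (hN : ∀ v, S (ψ v) = N) :
    SqBound (Measure.pi fun i => multivariateGaussian 0 (S i))
      (fun ω => quadStat (fun u => ω (φ u)) (fun v => ω (ψ v)) - frobSq (M - N))
      (96 * (frobSq (M - N) * (frobSq M / n₁ + frobSq N / n₂)) +
        208000 * ((frobSq M / n₁) ^ 2 + (frobSq N / n₂) ^ 2) +
        88000 * (frobSq M * frobSq N * (1 / (n₁ : ℝ) ^ 2 + 1 / (n₂ : ℝ) ^ 2))) := by
  obtain ⟨RA, hRA, hA⟩ := exists_traceSqEst_eq hS hn₁ φ hM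
  obtain ⟨RB, hRB, hB⟩ := exists_traceSqEst_eq hS hn₂ ψ hN
  obtain ⟨RC, hRC, hC⟩ := exists_traceMulEst_eq hS hn₁ hn₂ φ ψ hφψ hM hN
  have h1 := SqBound.average_bilin hS (by omega) φ hM (M - N)
  have h2 := SqBound.average_bilin hS (by omega) ψ hN (N - M)
  have hn₁' : (4 : ℝ) ≤ n₁ := by exact_mod_cast hn₁
  have hn₂' : (4 : ℝ) ≤ n₂ := by exact_mod_cast hn₂
  have e : (fun ω => quadStat (fun u => ω (φ u)) (fun v => ω (ψ v)) - frobSq (M - N)) = fun ω =>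
      ((2 / (n₁ : ℝ) * ∑ u, (bilin (M - N) (ω (φ u)) (ω (φ u)) - frobInner (M - N) M) +
        2 / (n₂ : ℝ) * ∑ v, (bilin (N - M) (ω (ψ v)) (ω (ψ v)) - frobInner (N - M) N)) +
      (RA ω + RB ω)) - 2 * RC ω := by
    ext ω
    rw [quadStat, hA, hB, hC, frobSq_sub, frobInner_sub_left, frobInner_sub_left, frobInner_self,
      frobInner_self, frobInner_comm N M]
    simp only [bilin_sub, Finset.sum_sub_distrib, Finset.sum_const, Finset.card_univ,
      Fintype.card_fin, nsmul_eq_mul]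
    field_simp
    ring
  rw [e]
  refine (((h1.add h2).add (hRA.add hRB)).sub (hRC.const_mul 2)).mono (le_of_eq ?_)
  rw [frobSq_sub_comm N M]
  ring

/-- The law of the pair of samples as a product measure over the union of the two index sets. -/
lemma sampleLaw_eq_pi {n₁ n₂ : ℕ} (S : PDMatrix p × PDMatrix p)
    (B : Set (Sample n₁ p × Sample n₂ p)) :
    sampleLaw n₁ n₂ S B = (Measure.pi fun i : Fin n₁ ⊕ Fin n₂ => multivariateGaussian 0
      (Sum.elim (fun _ => S.1.1) (fun _ => S.2.1) i))
        {ω | (((fun u => ω (Sum.inl u)), fun v => ω (Sum.inr v)) :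
          Sample n₁ p × Sample n₂ p) ∈ B} := by
  have h := measurePreserving_sumPiEquivProdPi (fun i : Fin n₁ ⊕ Fin n₂ =>
    (multivariateGaussian 0 (Sum.elim (fun _ => S.1.1) (fun _ => S.2.1) i) :
      Measure (EuclideanSpace ℝ (Fin p))))
  exact (h.measure_preimage_equiv B).symm

instance isProbabilityMeasure_sampleLaw {n₁ n₂ : ℕ} (S : PDMatrix p × PDMatrix p) :
    IsProbabilityMeasure (sampleLaw n₁ n₂ S) := by
  unfold sampleLaw
  infer_instance

lemma div_le_mul_div {F c m n : ℝ} (hF : 0 < F) (hm : 0 < m) (hn : 0 < n) (h : m ≤ c * n) :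
    F / n ≤ c * (F / m) := by
  rw [← mul_div_assoc, div_le_div_iff₀ hn hm]
  nlinarith

/-- The second moment bound of `SqBound.quadStat_sub` is negligible with respect to `Δ²`. -/
lemma dense_secondMoment_le {F₁ F₂ Δ c ε n₁ n₂ : ℝ} (hF₁ : 0 < F₁) (hF₂ : 0 < F₂) (hn₁ : 0 < n₁)
    (hn₂ : 0 < n₂) (hc : 1 ≤ c) (h12 : n₁ ≤ c * n₂) (h21 : n₂ ≤ c * n₁) (hε : 0 < ε) (hε1 : ε ≤ 1)
    (hΔ0 : 0 < Δ) (hdense : F₁ / n₁ + F₂ / n₂ ≤ ε * Δ) :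
    96 * (Δ * (F₁ / n₁ + F₂ / n₂)) + 208000 * ((F₁ / n₁) ^ 2 + (F₂ / n₂) ^ 2) +
      88000 * (F₁ * F₂ * (1 / n₁ ^ 2 + 1 / n₂ ^ 2)) ≤ 500000 * c * ε * Δ ^ 2 := by
  have hx1 := div_le_mul_div hF₁ hn₁ hn₂ h12
  have hx2 := div_le_mul_div hF₂ hn₂ hn₁ h21
  have hcross : F₁ * F₂ * (1 / n₁ ^ 2 + 1 / n₂ ^ 2) =
      F₁ / n₁ * (F₂ / n₁) + F₂ / n₂ * (F₁ / n₂) := by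
    field_simp
  have ha₁ : 0 < F₁ / n₁ := by positivity
  have ha₂ : 0 < F₂ / n₂ := by positivity
  rw [hcross]
  generalize F₁ / n₁ = a₁ at *
  generalize F₂ / n₂ = a₂ at *
  have f0 := mul_le_mul_of_nonneg_left hx2 ha₁.le
  have f0' := mul_le_mul_of_nonneg_left hx1 ha₂.le
  have f1 : Δ * (a₁ + a₂) ≤ ε * Δ ^ 2 := by
    calc Δ * (a₁ + a₂) ≤ Δ * (ε * Δ) := mul_le_mul_of_nonneg_left hdense hΔ0.le
      _ = _ := by ring
  have f2 : (a₁ + a₂) ^ 2 ≤ ε * Δ ^ 2 := by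
    calc (a₁ + a₂) ^ 2 ≤ (ε * Δ) ^ 2 := pow_le_pow_left₀ (by positivity) hdense 2
      _ = ε * (ε * Δ ^ 2) := by ring
      _ ≤ 1 * (ε * Δ ^ 2) := mul_le_mul_of_nonneg_right hε1 (by positivity)
      _ = _ := one_mul _
  have f3 : 0 < a₁ * a₂ := mul_pos ha₁ ha₂
  have f4 : a₁ * a₂ ≤ 1 / 2 * (ε * Δ ^ 2) := by nlinarith [sq_nonneg (a₁ - a₂)]
  have f5 : c * (a₁ * a₂) ≤ c * (1 / 2 * (ε * Δ ^ 2)) :=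
    mul_le_mul_of_nonneg_left f4 (by linarith)
  have f6 : ε * Δ ^ 2 ≤ c * (ε * Δ ^ 2) := le_mul_of_one_le_left (by positivity) hc
  have f7 : 0 ≤ c * (ε * Δ ^ 2) := by positivity
  linarith

/-- If `A`, `B` and `T` are within a factor of their targets, then `T` dominates its estimated
standard deviation. -/
lemma dense_ratio_ge {F₁ F₂ Δ c ε n₁ n₂ A B T : ℝ} (hF₁ : 0 < F₁) (hF₂ : 0 < F₂) (hn₁ : 0 < n₁)
    (hn₂ : 0 < n₂) (hc : 1 ≤ c) (h12 : n₁ ≤ c * n₂) (h21 : n₂ ≤ c * n₁) (hε : 0 < ε)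
    (hdense : F₁ / n₁ + F₂ / n₂ ≤ ε * Δ) (hT : Δ / 2 ≤ T)
    (hA1 : -(F₁ / 2) < A - F₁) (hA2 : A - F₁ < F₁ / 2) (hB1 : -(F₂ / 2) < B - F₂)
    (hB2 : B - F₂ < F₂ / 2) :
    1 / (6 * c * ε) ≤ T / (2 / n₂ * A + 2 / n₁ * B) := by
  have hx1 := div_le_mul_div hF₁ hn₁ hn₂ h12
  have hx2 := div_le_mul_div hF₂ hn₂ hn₁ h21
  have hA0 : 0 < A := by linarith
  have hB0 : 0 < B := by linarith
  have hsd0 : 0 < 2 / n₂ * A + 2 / n₁ * B := by positivity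
  have g1 : 2 / n₂ * A ≤ 3 * (F₁ / n₂) := by
    calc 2 / n₂ * A ≤ 2 / n₂ * (3 / 2 * F₁) :=
          mul_le_mul_of_nonneg_left (by linarith) (by positivity)
      _ = _ := by ring
  have g2 : 2 / n₁ * B ≤ 3 * (F₂ / n₁) := by
    calc 2 / n₁ * B ≤ 2 / n₁ * (3 / 2 * F₂) :=
          mul_le_mul_of_nonneg_left (by linarith) (by positivity)
      _ = _ := by ring
  have g3 : c * (F₁ / n₁ + F₂ / n₂) ≤ c * (ε * Δ) :=
    mul_le_mul_of_nonneg_left hdense (by linarith)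
  have g4 : Δ / 2 * (6 * c * ε) ≤ T * (6 * c * ε) :=
    mul_le_mul_of_nonneg_right hT (by positivity)
  rw [div_le_div_iff₀ (by positivity) hsd0]
  linarith

/-- Under a dense alternative the standardized quadratic form statistic is large, except on an
event of small probability. -/
lemma sampleLaw_quadStat_lt_le {n₁ n₂ : ℕ} (hn₁ : 4 ≤ n₁) (hn₂ : 4 ≤ n₂) {c ε : ℝ} (hc : 1 ≤ c)
    (h12 : (n₁ : ℝ) ≤ c * n₂) (h21 : (n₂ : ℝ) ≤ c * n₁) (hε : 0 < ε) (hε1 : ε ≤ 1) (hp : 0 < p)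
    {S : PDMatrix p × PDMatrix p} (hS : S ∈ denseAlt n₁ n₂ p ε) :
    sampleLaw n₁ n₂ S {Z | quadStat Z.1 Z.2 / quadStatSd Z.1 Z.2 < 1 / (6 * c * ε)} ≤
      ENNReal.ofReal (2000000 * c * ε) + ENNReal.ofReal (240000 / n₁) +
        ENNReal.ofReal (240000 / n₂) := by
  have hn₁' : (4 : ℝ) ≤ n₁ := by exact_mod_cast hn₁
  have hn₂' : (4 : ℝ) ≤ n₂ := by exact_mod_cast hn₂
  obtain ⟨⟨M, hM⟩, ⟨N, hN⟩⟩ := S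
  have hpos : ∀ L : Matrix (Fin p) (Fin p) ℝ, L.PosDef → 0 < frobSq L := by
    intro L hL
    have h1 : 0 < L ⟨0, hp⟩ ⟨0, hp⟩ ^ 2 := pow_pos hL.diag_pos 2
    refine h1.trans_le ?_
    exact (Finset.single_le_sum (f := fun b => L ⟨0, hp⟩ b ^ 2) (fun _ _ => sq_nonneg _)
      (Finset.mem_univ _)).trans (Finset.single_le_sum (f := fun a => ∑ b, L a b ^ 2)
        (fun _ _ => Finset.sum_nonneg fun _ _ => sq_nonneg _) (Finset.mem_univ _))
  have hF1 := hpos M hM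
  have hF2 := hpos N hN
  have hdense : frobSq M / n₁ + frobSq N / n₂ ≤ ε * frobSq (M - N) := by
    have : (M ^ 2).trace / n₁ + (N ^ 2).trace / n₂ ≤ ε * ((M - N) ^ 2).trace := hS
    rwa [trace_sq_eq_frobSq hM.isHermitian, trace_sq_eq_frobSq hN.isHermitian,
      trace_sq_eq_frobSq (hM.isHermitian.sub hN.isHermitian)] at this
  set S' : Fin n₁ ⊕ Fin n₂ → Matrix (Fin p) (Fin p) ℝ :=
    Sum.elim (fun _ => M) (fun _ => N) with hS'
  have hpsd : ∀ i, (S' i).PosSemidef := by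
    rintro (u | v)
    exacts [hM.posSemidef, hN.posSemidef]
  set a₁ := frobSq M / n₁ with ha₁
  set a₂ := frobSq N / n₂ with ha₂
  set Δ := frobSq (M - N) with hΔ
  have ha₁0 : 0 < a₁ := by positivity
  have ha₂0 : 0 < a₂ := by positivity
  have hΔ0 : 0 < Δ := by
    by_contra h
    have : ε * Δ ≤ 0 := mul_nonpos_of_nonneg_of_nonpos hε.le (not_lt.1 h)
    linarith
  have hT := SqBound.quadStat_sub hpsd hn₁ hn₂ Embedding.inl Embedding.inr
    (fun u v => Sum.inl_ne_inr) (M := M) (N := N) (fun _ => rfl) (fun _ => rfl)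
  have hA := SqBound.traceSqEst_sub hpsd hn₁ Embedding.inl (M := M) (fun _ => rfl)
  have hB := SqBound.traceSqEst_sub hpsd hn₂ Embedding.inr (M := N) (fun _ => rfl)
  simp only [Embedding.inl_apply, Embedding.inr_apply] at hT hA hB
  have hTbound := dense_secondMoment_le hF1 hF2 (by linarith) (by linarith) hc h12 h21 hε hε1
    hΔ0 hdense
  have hT' := (hT.mono hTbound).meas_le (half_pos hΔ0)
  have hA' := hA.meas_le (half_pos hF1)
  have hB' := hB.meas_le (half_pos hF2)
  rw [sampleLaw_eq_pi]
  refine (measure_mono ?_).trans ((measure_union_le _ _).trans (add_le_add ((measure_union_le _ _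
    ).trans (add_le_add (hT'.trans (ENNReal.ofReal_le_ofReal ?_)) (hA'.trans
      (ENNReal.ofReal_le_ofReal ?_)))) (hB'.trans (ENNReal.ofReal_le_ofReal ?_))))
  · intro ω hω
    simp only [Set.mem_ofPred_eq] at hω
    by_contra hcon
    simp only [Set.mem_union, Set.mem_ofPred_eq, not_or, not_le, abs_lt] at hcon
    obtain ⟨⟨⟨hT1, _⟩, hA1, hA2⟩, hB1, hB2⟩ := hcon
    exact absurd hω (not_lt.2 (dense_ratio_ge hF1 hF2 (by linarith) (by linarith) hc h12 h21 hε
      hdense (by linarith) hA1 hA2 hB1 hB2))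
  · rw [div_le_iff₀ (by positivity)]
    exact le_of_eq (by ring)
  · rw [div_le_iff₀ (by positivity)]
    exact le_of_eq (by field_simp; norm_num)
  · rw [div_le_iff₀ (by positivity)]
    exact le_of_eq (by field_simp; norm_num)

end Dense

/-! ### The maximum form statistic under sparse alternatives -/

section Sparse

variable {p : ℕ} {S : Matrix (Fin p) (Fin p) ℝ}

lemma SqBound.meas_sq_le {Ω : Type*} {mΩ : MeasurableSpace Ω} {μ : Measure Ω}
    [IsProbabilityMeasure μ] {f : Ω → ℝ} {K t : ℝ} (hf : SqBound μ f K) (ht : 0 < t) :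
    μ {ω | t ≤ f ω ^ 2} ≤ ENNReal.ofReal (K / t) :=
  (hf.1.pow 2).meas_le (fun _ => sq_nonneg _) hf.2 ht

lemma integral_coord_pow (hS : S.PosSemidef) (i : Fin p) (m : ℕ) :
    ∫ x, x i ^ m ∂multivariateGaussian 0 S = √(S i i) ^ m * ∫ t, t ^ m ∂gaussianReal 0 1 := by
  have h : MeasurePreserving (fun x : EuclideanSpace ℝ (Fin p) => x i) (multivariateGaussian 0 S)
      (gaussianReal 0 (S i i).toNNReal) := measurePreserving_eval_multivariateGaussian hS
  rw [← integral_pow_gaussianReal hS.diag_nonneg,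
    ← integral_comp_of_measurePreserving (F := fun t => t ^ m) (by fun_prop) h]

/-- The eighth moment of the standard normal law. -/
def normalMoment8 : ℝ := ∫ t, t ^ 8 ∂gaussianReal 0 1

lemma normalMoment8_nonneg : 0 ≤ normalMoment8 := integral_nonneg fun t => by positivity

lemma integral_coord_mul_sub_sq (hS : S.PosSemidef) (i j : Fin p) :
    ∫ x, (x i * x j - S i j) ^ 2 ∂multivariateGaussian 0 S = S i i * S j j + S i j ^ 2 := by
  have e : ∀ x : EuclideanSpace ℝ (Fin p), (x i * x j - S i j) ^ 2 =
      x i * x i * (x j * x j) - (2 * S i j) * (x i * x j) + S i j ^ 2 := fun x => by ring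
  simp_rw [e]
  rw [integral_add (HasMoments.integrable (by fun_prop)) (HasMoments.integrable (by fun_prop)),
    integral_sub (HasMoments.integrable (by fun_prop)) (HasMoments.integrable (by fun_prop)),
    integral_const_mul, integral_coord_four hS, integral_coord_mul hS]
  simp
  ring

/-- The variance of `X_i X_j` is `σ_ii σ_jj + σ_ij²`. -/
lemma theta_eq (S : PDMatrix p) (i j : Fin p) :
    theta S i j = S.1 i i * S.1 j j + S.1 i j ^ 2 := by
  have hS := S.2.posSemidef
  rw [theta, variance_eq_integral
    (HasMoments.integrable (by fun_prop)).aestronglyMeasurable.aemeasurable,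
    integral_coord_mul hS, integral_coord_mul_sub_sq hS]

lemma theta_pos (S : PDMatrix p) (i j : Fin p) : 0 < theta S i j := by
  rw [theta_eq]
  have h1 := S.2.diag_pos (i := i)
  have h2 := S.2.diag_pos (i := j)
  positivity

/-- The fourth central moment of `x_i x_j` is of the order of the squared variance. -/
lemma SqBound.coord_mul_sub_sq (hS : S.PosDef) (i j : Fin p) :
    SqBound (multivariateGaussian 0 S) (fun x => (x i * x j - S i j) ^ 2)
      (8 * (normalMoment8 + 1) * (S i i * S j j + S i j ^ 2) ^ 2) := by
  refine ⟨by fun_prop, ?_⟩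
  have ha : 0 < S i i := hS.diag_pos
  have hb : 0 < S j j := hS.diag_pos
  set a := S i i
  set b := S j j
  have h8 : ∀ k, ∫ x, x k ^ 8 ∂multivariateGaussian 0 S = S k k ^ 4 * normalMoment8 := by
    intro k
    rw [integral_coord_pow hS.posSemidef, normalMoment8,
      show √(S k k) ^ 8 = (√(S k k) ^ 2) ^ 4 by ring, Real.sq_sqrt hS.diag_pos.le]
  calc ∫ x, ((x i * x j - S i j) ^ 2) ^ 2 ∂multivariateGaussian 0 S
      ≤ ∫ x, (4 * b ^ 2 / a ^ 2 * x i ^ 8 + 4 * a ^ 2 / b ^ 2 * x j ^ 8 + 8 * S i j ^ 4)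
          ∂multivariateGaussian 0 S := by
        refine integral_mono (HasMoments.integrable (by fun_prop))
          (HasMoments.integrable (by fun_prop)) fun x => ?_
        simp only
        have h1 : ((x i * x j - S i j) ^ 2) ^ 2 ≤ 8 * (x i ^ 4 * x j ^ 4) + 8 * S i j ^ 4 := by
          have e1 : (x i * x j - S i j) ^ 2 ≤ 2 * (x i * x j) ^ 2 + 2 * S i j ^ 2 := by
            nlinarith [sq_nonneg (x i * x j + S i j)]
          have e2 := pow_le_pow_left₀ (sq_nonneg _) e1 2
          nlinarith [sq_nonneg ((x i * x j) ^ 2 - S i j ^ 2)]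
        have h2 : 8 * (x i ^ 4 * x j ^ 4) ≤
            4 * b ^ 2 / a ^ 2 * x i ^ 8 + 4 * a ^ 2 / b ^ 2 * x j ^ 8 := by
          have e1 := sq_nonneg (b / a * x i ^ 4 - a / b * x j ^ 4)
          have e2 : (b / a * x i ^ 4 - a / b * x j ^ 4) ^ 2 =
              b ^ 2 / a ^ 2 * x i ^ 8 + a ^ 2 / b ^ 2 * x j ^ 8 - 2 * (x i ^ 4 * x j ^ 4) := by
            field_simp
            ring
          rw [e2] at e1
          have e3 : 4 * b ^ 2 / a ^ 2 * x i ^ 8 = 4 * (b ^ 2 / a ^ 2 * x i ^ 8) := by ring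
          have e4 : 4 * a ^ 2 / b ^ 2 * x j ^ 8 = 4 * (a ^ 2 / b ^ 2 * x j ^ 8) := by ring
          linarith
        linarith
    _ = 8 * normalMoment8 * (a * b) ^ 2 + 8 * (S i j ^ 2) ^ 2 := by
        rw [integral_add (HasMoments.integrable (by fun_prop))
          (HasMoments.integrable (by fun_prop)),
          integral_add (HasMoments.integrable (by fun_prop))
          (HasMoments.integrable (by fun_prop)), integral_const_mul, integral_const_mul, h8, h8]
        simp
        field_simp
        ring
    _ ≤ _ := by
        have hab : 0 < a * b := mul_pos ha hb
        have hs : 0 ≤ S i j ^ 2 := sq_nonneg _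
        generalize a * b = v at *
        generalize S i j ^ 2 = s at *
        have h1 : v ^ 2 ≤ (v + s) ^ 2 := pow_le_pow_left₀ hab.le (by linarith) 2
        have h2 : s ^ 2 ≤ (v + s) ^ 2 := pow_le_pow_left₀ hs (by linarith) 2
        have h3 := mul_le_mul_of_nonneg_left h1 normalMoment8_nonneg
        linarith

/-- The average of `g` over a sample. -/
def sampleAverage {n : ℕ} (g : EuclideanSpace ℝ (Fin p) → ℝ) (X : Sample n p) : ℝ :=
  (1 / (n : ℝ)) * ∑ u, g (X u)

/-- Second moment of the centred average of `g` over an i.i.d. sample. -/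
lemma SqBound.sampleAverage_sub {n : ℕ} (hn : 0 < n) {g : EuclideanSpace ℝ (Fin p) → ℝ} {K m : ℝ}
    (hg : SqBound (multivariateGaussian 0 S) g K) (hm : ∫ x, g x ∂multivariateGaussian 0 S = m) :
    SqBound (Measure.pi fun _ : Fin n => multivariateGaussian 0 S)
      (fun X => sampleAverage g X - m) (K / n) := by
  have hn' : (0 : ℝ) < n := by exact_mod_cast hn
  have h := SqBound.sum_coordinates (μ := fun _ : Fin n => multivariateGaussian 0 S)
    (φ := Function.Embedding.refl _) (g := fun x => g x - m) (fun _ => hg.sub_integral hm)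
    (fun _ => by
      rw [integral_sub hg.1.integrable (HasMoments.const _).integrable, hm]
      simp)
  have e : (fun X : Sample n p => sampleAverage g X - m) = fun X =>
      (1 / (n : ℝ)) * ∑ u, (g (X (Function.Embedding.refl _ u)) - m) := by
    ext X
    simp only [sampleAverage, Finset.sum_sub_distrib, Finset.sum_const, Finset.card_univ,
      Fintype.card_fin, nsmul_eq_mul, Function.Embedding.refl_apply]
    field_simp
  rw [e]
  refine (h.const_mul _).mono (le_of_eq ?_)
  rw [Fintype.card_fin]
  field_simp

/-- A deterministic bound of the estimators `σ̂_{ij}` and `θ̂_{ij}` in terms of averages of the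
uncentred data. -/
lemma sampleCov_thetaEst_bounds {n : ℕ} {L : ℝ} (hL : 1 ≤ L) (hn : 1000 * L ^ 4 ≤ n)
    {a b s : ℝ} (ha : 0 < a) (hb : 0 < b) {X : Sample n p} {i j : Fin p}
    (hxy : sampleAverage (fun x => x i * x j - s) X ^ 2 ≤ L ^ 2 * ((a * b + s ^ 2) / n))
    (hx : sampleAverage (fun x => x i) X ^ 2 ≤ L ^ 2 * (a / n))
    (hy : sampleAverage (fun x => x j) X ^ 2 ≤ L ^ 2 * (b / n))
    (hxx : sampleAverage (fun x => x i ^ 2) X ≤ L ^ 2 * a)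
    (hyy : sampleAverage (fun x => x j ^ 2) X ≤ L ^ 2 * b)
    (hq1 : sampleAverage (fun x => (x i * x j - s) ^ 2) X ≤ 11 / 10 * (a * b + s ^ 2))
    (hq2 : 9 / 10 * (a * b + s ^ 2) ≤ sampleAverage (fun x => (x i * x j - s) ^ 2) X) :
    (sampleCov X i j - s) ^ 2 ≤ 4 * L ^ 2 * ((a * b + s ^ 2) / n) ∧ 0 < thetaEst X i j ∧
      thetaEst X i j ≤ 5 / 2 * (a * b + s ^ 2) := by
  have hL2 : 1 ≤ L ^ 2 := one_le_pow₀ hL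
  have hL4 : L ^ 2 ≤ L ^ 4 := pow_le_pow_right₀ hL (by norm_num)
  have hn0 : (0 : ℝ) < n := by linarith
  have hne : (n : ℝ) ≠ 0 := hn0.ne'
  set θ := a * b + s ^ 2 with hθ
  have hab : 0 < a * b := mul_pos ha hb
  have hθ0 : 0 < θ := by positivity
  have habθ : a * b ≤ θ := by rw [hθ]; linarith [sq_nonneg s]
  set mx := sampleAverage (fun x => x i) X with hmx
  set my := sampleAverage (fun x => x j) X with hmy
  set mw := sampleAverage (fun x => x i * x j - s) X with hmw
  set mxx := sampleAverage (fun x => x i ^ 2) X with hmxx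
  set myy := sampleAverage (fun x => x j ^ 2) X with hmyy
  set mq := sampleAverage (fun x => (x i * x j - s) ^ 2) X with hmq
  simp only [sampleAverage] at hmx hmy hmw hmxx hmyy hmq
  have sx : ∑ u, X u i = n * mx := by rw [hmx]; field_simp
  have sy : ∑ u, X u j = n * my := by rw [hmy]; field_simp
  have sw : ∑ u, (X u i * X u j - s) = n * mw := by rw [hmw]; field_simp
  have sxx : ∑ u, X u i ^ 2 = n * mxx := by rw [hmxx]; field_simp
  have syy : ∑ u, X u j ^ 2 = n * myy := by rw [hmyy]; field_simp
  have sq' : ∑ u, (X u i * X u j - s) ^ 2 = n * mq := by rw [hmq]; field_simp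
  have hmean : sampleMean X i = mx ∧ sampleMean X j = my := ⟨rfl, rfl⟩
  -- the error made by centring at the sample means
  set R : Fin n → ℝ := fun u => mx * my - mx * X u j - my * X u i with hR
  have hW : ∀ u, (X u i - sampleMean X i) * (X u j - sampleMean X j) =
      (X u i * X u j - s) + R u + s := by
    intro u
    rw [hmean.1, hmean.2, hR]
    ring
  have hcov : sampleCov X i j - s = mw - mx * my := by
    have e : ∑ u, R u = -(n * (mx * my)) := by
      simp only [hR, Finset.sum_sub_distrib, ← Finset.mul_sum, sx, sy, Finset.sum_const,
        Finset.card_univ, Fintype.card_fin, nsmul_eq_mul]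
      ring
    simp only [sampleCov, hW, Finset.sum_add_distrib, sw, e, Finset.sum_const, Finset.card_univ,
      Fintype.card_fin, nsmul_eq_mul]
    field_simp
    ring
  have hmxmy : mx ^ 2 * my ^ 2 ≤ L ^ 2 * (a / n) * (L ^ 2 * (b / n)) :=
    mul_le_mul hx hy (sq_nonneg _) (by positivity)
  have hsmall : L ^ 2 * (a / n) * (L ^ 2 * (b / n)) ≤ L ^ 2 * (θ / n) := by
    have e : L ^ 2 * (a / n) * (L ^ 2 * (b / n)) = L ^ 2 * (a * b / n) * (L ^ 2 / n) := by
      field_simp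
    have h1 : L ^ 2 / n ≤ 1 := by
      rw [div_le_one hn0]
      linarith
    rw [e]
    calc L ^ 2 * (a * b / n) * (L ^ 2 / n) ≤ L ^ 2 * (a * b / n) * 1 :=
          mul_le_mul_of_nonneg_left h1 (by positivity)
      _ ≤ L ^ 2 * (θ / n) := by
          rw [mul_one]
          gcongr
  have hcov2 : (sampleCov X i j - s) ^ 2 ≤ 4 * L ^ 2 * (θ / n) := by
    rw [hcov]
    linarith [sq_nonneg (mw + mx * my)]
  have hLθ : L ^ 2 * (θ / n) ≤ θ / 1000 := by
    have h1 : L ^ 2 * 1000 * θ ≤ n * θ := mul_le_mul_of_nonneg_right (by linarith) hθ0.le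
    rw [← mul_div_assoc, div_le_div_iff₀ hn0 (by norm_num)]
    linarith
  have hRsq : ∑ u, R u ^ 2 ≤ n * (θ / 100) := by
    have h1 : ∑ u, R u ^ 2 ≤ ∑ u, (3 * (mx ^ 2 * my ^ 2) + 3 * mx ^ 2 * X u j ^ 2 +
        3 * my ^ 2 * X u i ^ 2) := by
      refine Finset.sum_le_sum fun u _ => ?_
      simp only [hR]
      linarith [sq_nonneg (mx * my + mx * X u j), sq_nonneg (mx * my + my * X u i),
        sq_nonneg (mx * X u j - my * X u i)]
    have h2 : ∑ u, (3 * (mx ^ 2 * my ^ 2) + 3 * mx ^ 2 * X u j ^ 2 + 3 * my ^ 2 * X u i ^ 2) =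
        n * (3 * (mx ^ 2 * my ^ 2) + 3 * (mx ^ 2 * myy) + 3 * (my ^ 2 * mxx)) := by
      simp only [Finset.sum_add_distrib, ← Finset.mul_sum, sxx, syy, Finset.sum_const,
        Finset.card_univ, Fintype.card_fin, nsmul_eq_mul]
      ring
    have h3 : L ^ 4 / n ≤ 1 / 1000 := by
      rw [div_le_div_iff₀ hn0 (by norm_num)]
      linarith
    have hmyy0 : 0 ≤ myy := by rw [hmyy]; positivity
    have hmxx0 : 0 ≤ mxx := by rw [hmxx]; positivity
    have h4 : mx ^ 2 * myy ≤ a * b * (L ^ 4 / n) := by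
      calc mx ^ 2 * myy ≤ L ^ 2 * (a / n) * (L ^ 2 * b) :=
            mul_le_mul hx hyy hmyy0 (by positivity)
        _ = _ := by ring
    have h5 : my ^ 2 * mxx ≤ a * b * (L ^ 4 / n) := by
      calc my ^ 2 * mxx ≤ L ^ 2 * (b / n) * (L ^ 2 * a) :=
            mul_le_mul hy hxx hmxx0 (by positivity)
        _ = _ := by ring
    have h6 : a * b * (L ^ 4 / n) ≤ a * b * (1 / 1000) := mul_le_mul_of_nonneg_left h3 hab.le
    rw [h2] at h1
    refine h1.trans (mul_le_mul_of_nonneg_left ?_ hn0.le)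
    linarith
  -- `θ̂` is the mean square of the centred products minus the square of their mean
  have htheta : thetaEst X i j = (1 / (n : ℝ)) * ∑ u, ((X u i * X u j - s) + R u) ^ 2 -
      (sampleCov X i j - s) ^ 2 := by
    have e1 : ∑ u, ((X u i * X u j - s) + R u) = n * (sampleCov X i j - s) := by
      simp only [sampleCov, hW, Finset.sum_add_distrib, Finset.sum_const, Finset.card_univ,
        Fintype.card_fin, nsmul_eq_mul]
      field_simp
      ring
    have e2 : ∀ u, ((X u i - sampleMean X i) * (X u j - sampleMean X j) - sampleCov X i j) ^ 2 =
        ((X u i * X u j - s) + R u) ^ 2 - 2 * (sampleCov X i j - s) *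
          ((X u i * X u j - s) + R u) + (sampleCov X i j - s) ^ 2 := by
      intro u
      rw [hW]
      ring
    simp only [thetaEst, e2]
    rw [Finset.sum_add_distrib, Finset.sum_sub_distrib, ← Finset.mul_sum, e1, Finset.sum_const,
      Finset.card_univ, Fintype.card_fin, nsmul_eq_mul]
    field_simp
    ring
  have hup : ∑ u, ((X u i * X u j - s) + R u) ^ 2 ≤ n * (2 * mq) + 2 * ∑ u, R u ^ 2 := by
    have : n * (2 * mq) + 2 * ∑ u, R u ^ 2 =
        ∑ u, (2 * (X u i * X u j - s) ^ 2 + 2 * R u ^ 2) := by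
      rw [Finset.sum_add_distrib, ← Finset.mul_sum, ← Finset.mul_sum, sq']
      ring
    rw [this]
    refine Finset.sum_le_sum fun u _ => ?_
    linarith [sq_nonneg ((X u i * X u j - s) - R u)]
  have hlow : n * (1 / 2 * mq) - ∑ u, R u ^ 2 ≤ ∑ u, ((X u i * X u j - s) + R u) ^ 2 := by
    have : n * (1 / 2 * mq) - ∑ u, R u ^ 2 =
        ∑ u, (1 / 2 * (X u i * X u j - s) ^ 2 - R u ^ 2) := by
      rw [Finset.sum_sub_distrib, ← Finset.mul_sum, sq']
      ring
    rw [this]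
    refine Finset.sum_le_sum fun u _ => ?_
    linarith [sq_nonneg ((X u i * X u j - s) + 2 * R u)]
  refine ⟨hcov2, ?_, ?_⟩
  · rw [htheta]
    have h1 : 1 / (n : ℝ) * (n * (1 / 2 * mq) - n * (θ / 100)) ≤
        1 / (n : ℝ) * ∑ u, ((X u i * X u j - s) + R u) ^ 2 :=
      mul_le_mul_of_nonneg_left (by linarith) (by positivity)
    have h2 : 1 / (n : ℝ) * (n * (1 / 2 * mq) - n * (θ / 100)) = 1 / 2 * mq - θ / 100 := by
      field_simp
    linarith
  · rw [htheta]
    have h1 : 1 / (n : ℝ) * ∑ u, ((X u i * X u j - s) + R u) ^ 2 ≤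
        1 / (n : ℝ) * (n * (2 * mq) + 2 * (n * (θ / 100))) :=
      mul_le_mul_of_nonneg_left (by linarith) (by positivity)
    have h2 : 1 / (n : ℝ) * (n * (2 * mq) + 2 * (n * (θ / 100))) = 2 * mq + 2 * (θ / 100) := by
      field_simp
    linarith [sq_nonneg (sampleCov X i j - s)]

/-- For a fixed entry, the sample covariance is within `O(√(θ / n))` of its target, and `θ̂` is
positive and at most `5 θ / 2`, except on an event of small probability. -/
lemma pi_sampleCov_thetaEst_le (S : PDMatrix p) (i j : Fin p) {n : ℕ} {L : ℝ} (hL : 1 ≤ L)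
    (hn : 1000 * L ^ 4 ≤ n) :
    (Measure.pi fun _ : Fin n => multivariateGaussian 0 S.1)
      {X | ¬ ((sampleCov X i j - S.1 i j) ^ 2 ≤ 4 * L ^ 2 * (theta S i j / n) ∧
        0 < thetaEst X i j ∧ thetaEst X i j ≤ 5 / 2 * theta S i j)} ≤
      ENNReal.ofReal (5 / L ^ 2 + 800 * (normalMoment8 + 1) / n) := by
  have hpsd := S.2.posSemidef
  have ha : 0 < S.1 i i := S.2.diag_pos
  have hb : 0 < S.1 j j := S.2.diag_pos
  have hθ := theta_pos S i j
  have hθe := theta_eq S i j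
  have hn0 : (0 : ℝ) < n := by nlinarith [one_le_pow₀ hL (n := 4)]
  have hnn : 0 < n := by exact_mod_cast hn0
  set P := Measure.pi fun _ : Fin n => multivariateGaussian 0 S.1
  have hcoord : ∀ k, SqBound (multivariateGaussian 0 S.1) (fun x => x k) (S.1 k k) := fun k =>
    ⟨by fun_prop, by
      have := integral_coord_mul hpsd k k
      simp_rw [← sq] at this
      exact this.le⟩
  have e1 : P {X | L ^ 2 * (theta S i j / n) ≤
      (sampleAverage (fun x => x i * x j - S.1 i j) X - 0) ^ 2} ≤ ENNReal.ofReal (1 / L ^ 2) := by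
    have h : SqBound (multivariateGaussian 0 S.1) (fun x => x i * x j - S.1 i j) (theta S i j) :=
      ⟨by fun_prop, by rw [integral_coord_mul_sub_sq hpsd, hθe]⟩
    refine ((SqBound.sampleAverage_sub hnn h (m := 0) ?_).meas_sq_le (by positivity)).trans
      (ENNReal.ofReal_le_ofReal (le_of_eq (by field_simp)))
    rw [integral_sub (HasMoments.integrable (by fun_prop)) (HasMoments.integrable (by fun_prop)),
      integral_coord_mul hpsd]
    simp
  have e2 : ∀ k, 0 < S.1 k k → P {X | L ^ 2 * (S.1 k k / n) ≤
      (sampleAverage (fun x => x k) X - 0) ^ 2} ≤ ENNReal.ofReal (1 / L ^ 2) := fun k hk =>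
    ((SqBound.sampleAverage_sub hnn (hcoord k) (integral_coord k)).meas_sq_le
      (by positivity)).trans (ENNReal.ofReal_le_ofReal (le_of_eq (by field_simp)))
  have e3 : ∀ k, 0 < S.1 k k → P {X | L ^ 2 * S.1 k k ≤ sampleAverage (fun x => x k ^ 2) X} ≤
      ENNReal.ofReal (1 / L ^ 2) := by
    intro k hk
    have hm : HasMoments P fun X : Sample n p => sampleAverage (fun x => x k ^ 2) X := by
      unfold sampleAverage
      exact (HasMoments.const _).mul (HasMoments.sum fun u =>
        (hasMoments_eval_coord (S := fun _ => S.1) u k).pow 2)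
    refine (hm.meas_le (fun X => ?_) (K := S.1 k k) ?_ (by positivity)).trans
      (ENNReal.ofReal_le_ofReal (le_of_eq (by field_simp)))
    · unfold sampleAverage
      positivity
    · unfold sampleAverage
      rw [integral_const_mul, integral_finsetSum _ fun u _ =>
        ((hasMoments_eval_coord (S := fun _ => S.1) u k).pow 2).integrable]
      have h1 : ∀ u : Fin n, ∫ X : Sample n p, X u k ^ 2 ∂P = S.1 k k := by
        intro u
        have := integral_comp_of_measurePreserving (F := fun x => x k ^ 2) (by fun_prop)
          (measurePreserving_eval (fun _ : Fin n => multivariateGaussian 0 S.1) u)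
        refine this.trans ?_
        have h2 := integral_coord_mul hpsd k k
        simp_rw [← sq] at h2
        exact h2
      rw [Finset.sum_congr rfl fun u _ => h1 u]
      simp only [Finset.sum_const, Finset.card_univ, Fintype.card_fin, nsmul_eq_mul]
      exact le_of_eq (by field_simp)
  have e4 : P {X | (theta S i j / 10) ^ 2 ≤
      (sampleAverage (fun x => (x i * x j - S.1 i j) ^ 2) X - theta S i j) ^ 2} ≤
      ENNReal.ofReal (800 * (normalMoment8 + 1) / n) := by
    have h := SqBound.coord_mul_sub_sq S.2 i j
    rw [← hθe] at h
    refine ((SqBound.sampleAverage_sub hnn h ?_).meas_sq_le (by positivity)).trans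
      (ENNReal.ofReal_le_ofReal (le_of_eq ?_))
    · rw [integral_coord_mul_sub_sq hpsd, hθe]
    · field_simp
      ring
  have hsum : ENNReal.ofReal (5 / L ^ 2 + 800 * (normalMoment8 + 1) / n) =
      ENNReal.ofReal (1 / L ^ 2) + ENNReal.ofReal (1 / L ^ 2) + ENNReal.ofReal (1 / L ^ 2) +
      ENNReal.ofReal (1 / L ^ 2) + ENNReal.ofReal (1 / L ^ 2) +
      ENNReal.ofReal (800 * (normalMoment8 + 1) / n) := by
    have := normalMoment8_nonneg
    rw [← ENNReal.ofReal_add, ← ENNReal.ofReal_add, ← ENNReal.ofReal_add, ← ENNReal.ofReal_add,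
      ← ENNReal.ofReal_add]
    · congr 1
      ring
    all_goals positivity
  rw [hsum]
  refine (measure_mono ?_).trans ((measure_union_le _ _).trans (add_le_add ((measure_union_le _ _
    ).trans (add_le_add ((measure_union_le _ _).trans (add_le_add ((measure_union_le _ _).trans
    (add_le_add ((measure_union_le _ _).trans (add_le_add e1 (e2 i ha))) (e2 j hb))) (e3 i ha)))
    (e3 j hb))) e4))
  intro X hX
  simp only [Set.mem_ofPred_eq] at hX
  by_contra hcon
  simp only [Set.mem_union, Set.mem_ofPred_eq, not_or, not_le, sub_zero] at hcon
  obtain ⟨⟨⟨⟨⟨h1, h2⟩, h3⟩, h4⟩, h5⟩, h6⟩ := hcon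
  have h6' := abs_lt_of_sq_lt_sq h6 (by positivity)
  rw [abs_lt] at h6'
  rw [hθe] at h1 h6' hX
  exact hX (sampleCov_thetaEst_bounds hL hn ha hb h1.le h2.le h3.le h4.le h5.le (by linarith)
    (by linarith))

/-- Under a sparse alternative the maximum form statistic is larger than `5 log p`, up to a
constant, except on an event of small probability. -/
lemma sampleLaw_maxStat_lt_le {n₁ n₂ : ℕ} {L : ℝ} (hL : 1 ≤ L) (hn₁ : 1000 * L ^ 4 ≤ n₁)
    (hn₂ : 1000 * L ^ 4 ≤ n₂) (hp : 0 < p) {S : PDMatrix p × PDMatrix p}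
    (hS : S ∈ sparseAlt n₁ n₂ p) :
    sampleLaw n₁ n₂ S {Z | maxStat Z.1 Z.2 < 5 * Real.log p - 40 * L ^ 2} ≤
      ENNReal.ofReal (5 / L ^ 2 + 800 * (normalMoment8 + 1) / n₁) +
        ENNReal.ofReal (5 / L ^ 2 + 800 * (normalMoment8 + 1) / n₂) := by
  have : Nonempty (UpperPair p) := ⟨⟨(⟨0, hp⟩, ⟨0, hp⟩), le_rfl⟩⟩
  have hL4 : 1 ≤ L ^ 4 := one_le_pow₀ hL
  have hn₁0 : (0 : ℝ) < n₁ := by linarith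
  have hn₂0 : (0 : ℝ) < n₂ := by linarith
  -- an entry at which the maximum is attained
  obtain ⟨q, hq⟩ := exists_eq_ciSup_of_finite (f := fun q : UpperPair p =>
    |S.1.1 q.1.1 q.1.2 - S.2.1 q.1.1 q.1.2| /
      Real.sqrt (theta S.1 q.1.1 q.1.2 / n₁ + theta S.2 q.1.1 q.1.2 / n₂))
  have hS' : 4 * Real.sqrt (Real.log p) ≤ |S.1.1 q.1.1 q.1.2 - S.2.1 q.1.1 q.1.2| /
      Real.sqrt (theta S.1 q.1.1 q.1.2 / n₁ + theta S.2 q.1.1 q.1.2 / n₂) := by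
    rw [hq]
    exact hS
  obtain ⟨⟨i, j⟩, hij⟩ := q
  simp only at hS'
  set θ₁ := theta S.1 i j with hθ₁
  set θ₂ := theta S.2 i j with hθ₂
  have hθ₁0 : 0 < θ₁ := theta_pos _ _ _
  have hθ₂0 : 0 < θ₂ := theta_pos _ _ _
  set V := θ₁ / n₁ + θ₂ / n₂ with hV
  have hV0 : 0 < V := by positivity
  have hlog : 0 ≤ Real.log p := Real.log_natCast_nonneg p
  have hδ : 16 * Real.log p * V ≤ (S.1.1 i j - S.2.1 i j) ^ 2 := by
    rw [le_div_iff₀ (Real.sqrt_pos.2 hV0)] at hS'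
    have := pow_le_pow_left₀ (by positivity) hS' 2
    rw [sq_abs, mul_pow, mul_pow, Real.sq_sqrt hlog, Real.sq_sqrt hV0.le] at this
    linarith
  set G₁ := {X : Sample n₁ p | ¬ ((sampleCov X i j - S.1.1 i j) ^ 2 ≤ 4 * L ^ 2 * (θ₁ / n₁) ∧
        0 < thetaEst X i j ∧ thetaEst X i j ≤ 5 / 2 * θ₁)} with hG₁
  set G₂ := {X : Sample n₂ p | ¬ ((sampleCov X i j - S.2.1 i j) ^ 2 ≤ 4 * L ^ 2 * (θ₂ / n₂) ∧
        0 < thetaEst X i j ∧ thetaEst X i j ≤ 5 / 2 * θ₂)} with hG₂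
  have m1 := pi_sampleCov_thetaEst_le S.1 i j hL hn₁
  have m2 := pi_sampleCov_thetaEst_le S.2 i j hL hn₂
  have m1' : sampleLaw n₁ n₂ S (G₁ ×ˢ Set.univ) ≤
      ENNReal.ofReal (5 / L ^ 2 + 800 * (normalMoment8 + 1) / n₁) := by
    rw [sampleLaw, Measure.prod_prod, measure_univ, mul_one]
    exact m1
  have m2' : sampleLaw n₁ n₂ S (Set.univ ×ˢ G₂) ≤
      ENNReal.ofReal (5 / L ^ 2 + 800 * (normalMoment8 + 1) / n₂) := by
    rw [sampleLaw, Measure.prod_prod, measure_univ, one_mul]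
    exact m2
  refine (measure_mono ?_).trans ((measure_union_le _ _).trans (add_le_add m1' m2'))
  rintro ⟨X, Y⟩ hZ
  simp only [Set.mem_ofPred_eq] at hZ
  by_contra hcon
  simp only [Set.mem_union, Set.mem_prod, Set.mem_univ, and_true, true_and, not_or, hG₁, hG₂,
    Set.mem_ofPred_eq, not_not] at hcon
  obtain ⟨⟨x1, x2, x3⟩, y1, y2, y3⟩ := hcon
  have hmax : (sampleCov X i j - sampleCov Y i j) ^ 2 /
      (thetaEst X i j / n₁ + thetaEst Y i j / n₂) ≤ maxStat X Y :=
    le_ciSup (f := fun q : UpperPair p => (sampleCov X q.1.1 q.1.2 - sampleCov Y q.1.1 q.1.2) ^ 2 /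
      (thetaEst X q.1.1 q.1.2 / n₁ + thetaEst Y q.1.1 q.1.2 / n₂))
      (Set.finite_range _).bddAbove ⟨(i, j), hij⟩
  have hden0 : 0 < thetaEst X i j / n₁ + thetaEst Y i j / n₂ := by positivity
  have hden : thetaEst X i j / n₁ + thetaEst Y i j / n₂ ≤ 5 / 2 * V := by
    have h1 : thetaEst X i j / n₁ ≤ 5 / 2 * θ₁ / n₁ := div_le_div_of_nonneg_right x3 hn₁0.le
    have h2 : thetaEst Y i j / n₂ ≤ 5 / 2 * θ₂ / n₂ := div_le_div_of_nonneg_right y3 hn₂0.le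
    rw [hV]
    linarith [mul_div_assoc (5 / 2) θ₁ (n₁ : ℝ), mul_div_assoc (5 / 2) θ₂ (n₂ : ℝ)]
  have hlt := hmax.trans_lt hZ
  rw [div_lt_iff₀ hden0] at hlt
  set D := sampleCov X i j - sampleCov Y i j
  set δ := S.1.1 i j - S.2.1 i j
  have herr : (D - δ) ^ 2 ≤ 8 * L ^ 2 * V := by
    have e : D - δ = (sampleCov X i j - S.1.1 i j) - (sampleCov Y i j - S.2.1 i j) := by
      simp only [D, δ]
      ring
    rw [e, hV]
    linarith [sq_nonneg ((sampleCov X i j - S.1.1 i j) + (sampleCov Y i j - S.2.1 i j))]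
  -- weighted so that `16 / (11 / 10 * (5 / 2))` still exceeds `5`
  have hD : δ ^ 2 ≤ 11 / 10 * D ^ 2 + 11 * (D - δ) ^ 2 := by
    linarith [sq_nonneg (D + 10 * (D - δ))]
  by_cases hneg : 5 * Real.log p - 40 * L ^ 2 ≤ 0
  · have h1 := mul_nonpos_of_nonpos_of_nonneg hneg hden0.le
    linarith [sq_nonneg D]
  · have h1 : (5 * Real.log p - 40 * L ^ 2) * (thetaEst X i j / n₁ + thetaEst Y i j / n₂) ≤
        (5 * Real.log p - 40 * L ^ 2) * (5 / 2 * V) :=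
      mul_le_mul_of_nonneg_left hden (not_le.1 hneg).le
    have h2 : 0 ≤ Real.log p * V := by positivity
    have h3 : 0 < L ^ 2 * V := by positivity
    linarith

end Sparse

/-! ### Power of the combined test -/

section Combination

/-- The p-values are never `0`, so that their logarithms carry no junk value. -/
lemma pQuad_mem {n₁ n₂ p : ℕ} (X : Sample n₁ p) (Y : Sample n₂ p) :
    0 < pQuad X Y ∧ pQuad X Y ≤ 1 := by
  constructor
  · rw [pQuad, cdf_eq_real, ← probReal_compl_eq_one_sub measurableSet_Iic, Set.compl_Iic,
      measureReal_def, ENNReal.toReal_pos_iff]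
    refine ⟨pos_iff_ne_zero.2 fun h => ?_, measure_lt_top _ _⟩
    have := gaussianReal_absolutelyContinuous' 0 one_ne_zero h
    simp at this
  · rw [pQuad]
    linarith [cdf_nonneg (gaussianReal 0 1) (quadStat X Y / quadStatSd X Y)]

lemma pMax_mem {n₁ n₂ p : ℕ} (X : Sample n₁ p) (Y : Sample n₂ p) :
    0 < pMax X Y ∧ pMax X Y ≤ 1 := by
  rw [pMax, gumbelCDF]
  refine ⟨?_, by linarith [Real.exp_pos (-(1 / √(8 * Real.pi)) *
    Real.exp (-(maxStat X Y - 4 * Real.log p + Real.log (Real.log p)) / 2))]⟩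
  rw [sub_pos, Real.exp_lt_one_iff, neg_mul, neg_lt_zero]
  have := Real.pi_pos
  positivity

/-- Fisher's statistic is large as soon as one of the two p-values is small. -/
lemma le_fisherStat {n₁ n₂ p : ℕ} {X : Sample n₁ p} {Y : Sample n₂ p} {c : ℝ}
    (h : pQuad X Y ≤ Real.exp (-c / 2) ∨ pMax X Y ≤ Real.exp (-c / 2)) : c ≤ fisherStat X Y := by
  obtain ⟨hq0, hq1⟩ := pQuad_mem X Y
  obtain ⟨hm0, hm1⟩ := pMax_mem X Y
  have h1 := Real.log_nonpos hq0.le hq1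
  have h2 := Real.log_nonpos hm0.le hm1
  rw [fisherStat]
  rcases h with h | h
  · have := Real.log_le_log hq0 h
    rw [Real.log_exp] at this
    linarith
  · have := Real.log_le_log hm0 h
    rw [Real.log_exp] at this
    linarith

lemma tendsto_gumbelCDF_atTop : Tendsto gumbelCDF atTop (𝓝 1) := by
  have h1 : Tendsto (fun x : ℝ => Real.exp (-x / 2)) atTop (𝓝 0) :=
    Real.tendsto_exp_atBot.comp ((tendsto_neg_atTop_atBot).atBot_div_const (by norm_num))
  have h2 := (Real.continuous_exp.tendsto _).comp (h1.const_mul (-(1 / √(8 * Real.pi))))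
  rw [mul_zero, Real.exp_zero] at h2
  exact h2

/-- A lower bound of the power by the probability of the complement of an exceptional event, which
need not be measurable. -/
lemma le_fisherPower {n₁ n₂ p : ℕ} {S : PDMatrix p × PDMatrix p} {α δ : ℝ} (hδ : 0 ≤ δ)
    {B : Set (Sample n₁ p × Sample n₂ p)} (hB : sampleLaw n₁ n₂ S B ≤ ENNReal.ofReal δ)
    (h : ∀ Z ∉ B, upperQuantile (chiSquared 4) α ≤ fisherStat Z.1 Z.2) :
    ENNReal.ofReal (1 - δ) ≤ fisherPower α n₁ n₂ S := by
  rw [ENNReal.ofReal_sub _ hδ, ENNReal.ofReal_one, tsub_le_iff_right, fisherPower,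
    ← measure_univ (μ := sampleLaw n₁ n₂ S)]
  calc sampleLaw n₁ n₂ S Set.univ ≤ sampleLaw n₁ n₂ S
        ({Z | upperQuantile (chiSquared 4) α ≤ fisherStat Z.1 Z.2} ∪ B) := by
        refine measure_mono fun Z _ => ?_
        by_cases hZ : Z ∈ B
        · exact Or.inr hZ
        · exact Or.inl (h Z hZ)
    _ ≤ _ := (measure_union_le _ _).trans (by gcongr)

lemma denseAlt_mono {n₁ n₂ p : ℕ} {ε ε' : ℝ} (h : ε ≤ ε') :
    denseAlt n₁ n₂ p ε ⊆ denseAlt n₁ n₂ p ε' := by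
  intro S hS
  refine le_trans (show _ ≤ _ from hS) (mul_le_mul_of_nonneg_right h ?_)
  rw [trace_sq_eq_frobSq (S.1.2.isHermitian.sub S.2.2.isHermitian)]
  exact frobSq_nonneg _

/-- Uniform consistency over the dense alternatives. -/
lemma eventually_denseAlt_le_fisherPower {α : ℝ} {p n₁ n₂ : ℕ → ℕ} (hp : Tendsto p atTop atTop)
    (hn₁ : Tendsto n₁ atTop atTop) (hn₂ : Tendsto n₂ atTop atTop) {γ : ℝ} (hγ₀ : 0 < γ)
    (hγ₁ : γ < 1)
    (hγ : Tendsto (fun k => (n₁ k : ℝ) / ((n₁ k : ℝ) + (n₂ k : ℝ))) atTop (𝓝 γ))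
    {ε : ℕ → ℝ} (hε : Tendsto ε atTop (𝓝 0)) {δ : ℝ} (hδ : 0 < δ) :
    ∀ᶠ k in atTop, ∀ S ∈ denseAlt (n₁ k) (n₂ k) (p k) (ε k),
      ENNReal.ofReal (1 - δ) ≤ fisherPower α (n₁ k) (n₂ k) S := by
  set q := upperQuantile (chiSquared 4) α
  obtain ⟨t, ht⟩ := eventually_atTop.1 ((tendsto_cdf_atTop (gaussianReal 0 1)).eventually
    (lt_mem_nhds (show 1 - Real.exp (-q / 2) < 1 by linarith [Real.exp_pos (-q / 2)])))
  -- the sample sizes are comparable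
  set c := 2 / γ + 2 / (1 - γ) with hc
  have hγ' : 0 < 1 - γ := by linarith
  have hcγ : 2 / γ ≤ c := by rw [hc]; linarith [show 0 < 2 / (1 - γ) by positivity]
  have hcγ' : 2 / (1 - γ) ≤ c := by rw [hc]; linarith [show 0 < 2 / γ by positivity]
  have hc1 : 1 ≤ c := by
    refine le_trans ?_ hcγ
    rw [le_div_iff₀ hγ₀]
    linarith
  have hc0 : 0 < c := by linarith
  -- a level of separation at which the exceptional probability is small and the ratio large
  set ε' := min (min 1 (δ / (3 * (2000000 * c)))) (1 / (6 * c * (|t| + 1))) with hε'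
  have hε'0 : 0 < ε' := by positivity
  have hε'1 : ε' ≤ 1 := (min_le_left _ _).trans (min_le_left _ _)
  have hε'δ : 2000000 * c * ε' ≤ δ / 3 := by
    have h : ε' ≤ δ / (3 * (2000000 * c)) := (min_le_left _ _).trans (min_le_right _ _)
    rw [le_div_iff₀ (by positivity)] at h
    linarith
  have hε't : t ≤ 1 / (6 * c * ε') := by
    have h : ε' ≤ 1 / (6 * c * (|t| + 1)) := min_le_right _ _
    rw [le_div_iff₀ (by positivity)] at h ⊢
    have h1 : t * (6 * c * ε') ≤ (|t| + 1) * (6 * c * ε') :=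
      mul_le_mul_of_nonneg_right (by linarith [le_abs_self t]) (by positivity)
    linarith
  have hn₁R := (tendsto_natCast_atTop_atTop (R := ℝ)).comp hn₁
  have hn₂R := (tendsto_natCast_atTop_atTop (R := ℝ)).comp hn₂
  filter_upwards [hp.eventually_ge_atTop 1, hn₁.eventually_ge_atTop 4, hn₂.eventually_ge_atTop 4,
    hn₁R.eventually_ge_atTop (240000 / (δ / 3)), hn₂R.eventually_ge_atTop (240000 / (δ / 3)),
    hγ.eventually (lt_mem_nhds (half_lt_self hγ₀)),
    hγ.eventually (gt_mem_nhds (show γ < (1 + γ) / 2 by linarith)),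
    hε.eventually (gt_mem_nhds hε'0)] with k hpk h1 h2 h1δ h2δ hγ1 hγ2 hεk S hS
  have h1R : (4 : ℝ) ≤ n₁ k := by exact_mod_cast h1
  have h2R : (4 : ℝ) ≤ n₂ k := by exact_mod_cast h2
  simp only [Function.comp_apply] at h1δ h2δ
  have h12 : (n₁ k : ℝ) ≤ c * n₂ k := by
    rw [div_lt_iff₀ (by linarith)] at hγ2
    have : (n₁ k : ℝ) ≤ 2 / (1 - γ) * n₂ k := by
      rw [div_mul_eq_mul_div, le_div_iff₀ hγ']
      nlinarith
    exact this.trans (mul_le_mul_of_nonneg_right hcγ' (by linarith))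
  have h21 : (n₂ k : ℝ) ≤ c * n₁ k := by
    rw [lt_div_iff₀ (by linarith)] at hγ1
    have : (n₂ k : ℝ) ≤ 2 / γ * n₁ k := by
      rw [div_mul_eq_mul_div, le_div_iff₀ hγ₀]
      nlinarith
    exact this.trans (mul_le_mul_of_nonneg_right hcγ (by linarith))
  have hB := sampleLaw_quadStat_lt_le h1 h2 hc1 h12 h21 hε'0 hε'1 hpk (denseAlt_mono hεk.le hS)
  refine le_fisherPower hδ.le (hB.trans ?_) fun Z hZ => le_fisherStat (Or.inl ?_)
  · rw [← ENNReal.ofReal_add (by positivity) (by positivity),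
      ← ENNReal.ofReal_add (by positivity) (by positivity)]
    refine ENNReal.ofReal_le_ofReal ?_
    have e1 : 240000 / (n₁ k : ℝ) ≤ δ / 3 := by
      rw [div_le_iff₀ (by positivity)] at h1δ
      rw [div_le_iff₀ (by linarith)]
      linarith
    have e2 : 240000 / (n₂ k : ℝ) ≤ δ / 3 := by
      rw [div_le_iff₀ (by positivity)] at h2δ
      rw [div_le_iff₀ (by linarith)]
      linarith
    linarith
  · have hr := hε't.trans (not_lt.1 hZ)
    have := ht _ hr
    rw [pQuad]
    linarith

/-- Uniform consistency over the sparse alternatives. -/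
lemma eventually_sparseAlt_le_fisherPower {α : ℝ} {p n₁ n₂ : ℕ → ℕ} (hp : Tendsto p atTop atTop)
    (hn₁ : Tendsto n₁ atTop atTop) (hn₂ : Tendsto n₂ atTop atTop) {δ : ℝ} (hδ : 0 < δ) :
    ∀ᶠ k in atTop, ∀ S ∈ sparseAlt (n₁ k) (n₂ k) (p k),
      ENNReal.ofReal (1 - δ) ≤ fisherPower α (n₁ k) (n₂ k) S := by
  set q := upperQuantile (chiSquared 4) α
  obtain ⟨t, ht⟩ := eventually_atTop.1 (tendsto_gumbelCDF_atTop.eventually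
    (lt_mem_nhds (show 1 - Real.exp (-q / 2) < 1 by linarith [Real.exp_pos (-q / 2)])))
  -- the five events of probability `1 / L²` for each sample take up half of `δ`
  set L := max 1 (√(20 / δ)) with hL
  have hL1 : 1 ≤ L := le_max_left _ _
  have hLδ : 5 / L ^ 2 ≤ δ / 4 := by
    have h : 20 / δ ≤ L ^ 2 := by
      rw [← Real.sq_sqrt (show 0 ≤ 20 / δ by positivity)]
      exact pow_le_pow_left₀ (Real.sqrt_nonneg _) (le_max_right _ _) 2
    rw [div_le_iff₀ hδ] at h
    rw [div_le_iff₀ (by positivity)]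
    linarith
  have hm := normalMoment8_nonneg
  have hn₁R := (tendsto_natCast_atTop_atTop (R := ℝ)).comp hn₁
  have hn₂R := (tendsto_natCast_atTop_atTop (R := ℝ)).comp hn₂
  have hlog := Real.tendsto_log_atTop.comp ((tendsto_natCast_atTop_atTop (R := ℝ)).comp hp)
  filter_upwards [hp.eventually_ge_atTop 1, hn₁R.eventually_ge_atTop (1000 * L ^ 4),
    hn₂R.eventually_ge_atTop (1000 * L ^ 4),
    hn₁R.eventually_ge_atTop (800 * (normalMoment8 + 1) / (δ / 4)),
    hn₂R.eventually_ge_atTop (800 * (normalMoment8 + 1) / (δ / 4)),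
    hlog.eventually_ge_atTop 1, hlog.eventually_ge_atTop (t + 40 * L ^ 2)]
    with k hpk h1 h2 h1δ h2δ hl1 hl2 S hS
  simp only [Function.comp_apply] at h1 h2 h1δ h2δ hl1 hl2
  have hL4 : 1 ≤ L ^ 4 := one_le_pow₀ hL1
  have h1R : (0 : ℝ) < n₁ k := by linarith
  have h2R : (0 : ℝ) < n₂ k := by linarith
  have hB := sampleLaw_maxStat_lt_le hL1 h1 h2 hpk hS
  refine le_fisherPower hδ.le (hB.trans ?_) fun Z hZ => le_fisherStat (Or.inr ?_)
  · rw [← ENNReal.ofReal_add (by positivity) (by positivity)]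
    refine ENNReal.ofReal_le_ofReal ?_
    have e1 : 800 * (normalMoment8 + 1) / (n₁ k : ℝ) ≤ δ / 4 := by
      rw [div_le_iff₀ (by positivity)] at h1δ
      rw [div_le_iff₀ h1R]
      linarith
    have e2 : 800 * (normalMoment8 + 1) / (n₂ k : ℝ) ≤ δ / 4 := by
      rw [div_le_iff₀ (by positivity)] at h2δ
      rw [div_le_iff₀ h2R]
      linarith
    linarith
  · have hM : 5 * Real.log (p k) - 40 * L ^ 2 ≤ maxStat Z.1 Z.2 := not_lt.1 hZ
    have hll : 0 ≤ Real.log (Real.log (p k)) := Real.log_nonneg hl1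
    have := ht (maxStat Z.1 Z.2 - 4 * Real.log (p k) + Real.log (Real.log (p k))) (by linarith)
    rw [pMax]
    linarith

end Combination

end FisherCov

end
/-- Uniform asymptotic power of Fisher's test along any regime `n₁, n₂, p → ∞`. The infimum is taken
in `[0, 1]`, so that it is `1` over an empty set of covariance pairs. -/
theorem theorem3
    (α : ℝ) (hα₀ : 0 < α) (hα₁ : α < 1)
    (p n₁ n₂ : ℕ → ℕ)
    (hp : Filter.Tendsto p Filter.atTop Filter.atTop)
    (hn₁ : Filter.Tendsto n₁ Filter.atTop Filter.atTop)
    (hn₂ : Filter.Tendsto n₂ Filter.atTop Filter.atTop)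
    (γ : ℝ) (hγ₀ : 0 < γ) (hγ₁ : γ < 1)
    (hγ : Filter.Tendsto (fun k => (n₁ k : ℝ) / ((n₁ k : ℝ) + (n₂ k : ℝ))) Filter.atTop (nhds γ))
    (hlog : (fun k => Real.log (p k)) =o[Filter.atTop]
      fun k => ((n₁ k : ℝ) + (n₂ k : ℝ)) ^ ((1 : ℝ) / 5))
    (𝒞 : ∀ k, Set (FisherCov.PDMatrix (p k) × FisherCov.PDMatrix (p k)))
    (hspec : FisherCov.SpectrumSpread p 𝒞)
    (hcorr : FisherCov.WeaklyCorrelated p 𝒞)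
    (ε : ℕ → ℝ) (hε : Filter.Tendsto ε Filter.atTop (nhds 0)) :
    Filter.Tendsto
      (fun k => min 1 (⨅ S ∈ 𝒞 k ∩
          (FisherCov.denseAlt (n₁ k) (n₂ k) (p k) (ε k) ∪ FisherCov.sparseAlt (n₁ k) (n₂ k) (p k)),
        FisherCov.fisherPower α (n₁ k) (n₂ k) S))
      Filter.atTop (nhds 1) := by
  refine tendsto_order.2 ⟨fun a ha => ?_,
    fun a ha => .of_forall fun k => (min_le_left _ _).trans_lt ha⟩
  -- it suffices to bound the power below by `1 - δ` with `a < 1 - δ`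
  have ha' : a.toReal < 1 := by
    simpa using ENNReal.toReal_strict_mono ENNReal.one_ne_top ha
  set δ := (1 - a.toReal) / 2 with hδ
  have hδ0 : 0 < δ := by linarith
  have haδ : a < ENNReal.ofReal (1 - δ) :=
    (ENNReal.lt_ofReal_iff_toReal_lt ha.ne_top).2 (by linarith)
  filter_upwards [
    FisherCov.eventually_denseAlt_le_fisherPower (α := α) hp hn₁ hn₂ hγ₀ hγ₁ hγ hε hδ0,
    FisherCov.eventually_sparseAlt_le_fisherPower (α := α) hp hn₁ hn₂ hδ0] with k hd hs
  refine lt_min ha (haδ.trans_le (le_iInf₂ fun S hS => ?_))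
  exact hS.2.elim (hd S) (hs S)
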